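/- Let $d=2^n$, and let $H$ be the $d\times d$ Walsh–Hadamard matrix, $H(i,j)=d^{-1/2}(-1)^{\langle i,j\rangle}$, where $0\le i,j<d$ and $\langle i,j\rangle$ is the dot product of the binary representations of $i$ and $j$. A $k\times d$ matrix $B$ with entries $\pm k^{-1/2}$ is called *4-wise independent* if for all rows $i_1<i_2<i_3<i_4$ and all $(b_1,b_2,b_3,b_4)\in\{1,-1\}^4$ the number of columns $j$ with $(B_{i_1j},B_{i_2j},B_{i_3j},B_{i_4j})=k^{-1/2}(b_1,b_2,b_3,b_4)$ is exactly $d/16$; it is called a *code matrix* if each of its rows is $\sqrt{d/k}$ times a row of $H$. Put $A=BDHD'$, where $D$ and $D'$ are independent random $d\times d$ diagonal matrices whose diagonal entries are independent and take the values $1$ and $-1$ with probability $1/2$ each. There are universal constants $c_3,c_4,C>0$ such that the following hold. (a) For every $k$, every $d=2^n$, every $4$-wise independent $k\times d$ matrix $B$, every $x\in\mathbb{R}^d$ with $\|x\|_2=1$ and every $t>0$, $$\mathbb{P}\big(\,\big|\|Ax\|_2-1\big|>t\,\big)\le c_3\exp\big(-c_4\,k^{2/3}t^{4/3}\big).$$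 (b) Let $k\ge 2$ and $d=2^n$ be such that $d\ge 4k^2$ or, more generally, such that some $4$-wise independent $k\times d$ code matrix exists. Then there is a $4$-wise independent $k\times d$ code matrix $B$ such that, for every realization of the signs in $D$ and $D'$, the mapping $x\mapsto Ax$ can be computed in time $O(d\log k)$: there is a straight-line program, consisting of at most $C\,d\log k$ additions, subtractions and multiplications by real constants, that computes $Ax$ from every input $x\in\mathbb{R}^d$. -/

import Mathlib

open MeasureTheory ProbabilityTheory

namespace FastJL

noncomputable section

/-- The dot product `⟨i, j⟩` of the binary representations (with `n` digits) of `i` and `j`: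
the number of positions at which both have the digit `1`. -/
def bitDot (n i j : ℕ) : ℕ :=
  ((Finset.range n).filter fun b => i.testBit b = true ∧ j.testBit b = true).card

/-- The normalized `d × d` Walsh–Hadamard matrix, `d = 2 ^ n`, with rows and columns numbered
`0, …, d - 1`:  `H i j = d ^ (-1/2) * (-1) ^ ⟨i, j⟩`. -/
def walshHadamard (n : ℕ) : Matrix (Fin (2 ^ n)) (Fin (2 ^ n)) ℝ :=
  Matrix.of fun i j => (Real.sqrt (2 ^ n : ℝ))⁻¹ * (-1) ^ bitDot n i j

/-- A `k × d` matrix with entries `± k ^ (-1/2)` is 4-wise independent if, for any four rows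
`i₁ < i₂ < i₃ < i₄` and any signs `b`, exactly `d / 16` columns carry the pattern
`k ^ (-1/2) * b` in these rows.  (If `k ≥ 4` the condition on the entries follows from the
condition on the patterns, because the `16` patterns use up all `d` columns.) -/
def IsFourWiseIndependent {k d : ℕ} (B : Matrix (Fin k) (Fin d) ℝ) : Prop :=
  (∀ i j, B i j = (Real.sqrt k)⁻¹ ∨ B i j = -(Real.sqrt k)⁻¹) ∧
  ∀ i : Fin 4 → Fin k, StrictMono i →
    ∀ b : Fin 4 → ℝ, (∀ a, b a = 1 ∨ b a = -1) →
      16 * Nat.card {j : Fin d // ∀ a, B (i a) j = (Real.sqrt k)⁻¹ * b a} = d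

/-- A code matrix: every row is a row of the Walsh–Hadamard matrix, rescaled by `√(d / k)`
(so that the entries are `± k ^ (-1/2)` and the columns are unit vectors). -/
def IsCodeMatrix {k n : ℕ} (B : Matrix (Fin k) (Fin (2 ^ n)) ℝ) : Prop :=
  ∀ i, ∃ r, ∀ j, B i j = Real.sqrt ((2 ^ n : ℝ) / k) * walshHadamard n r j

/-- The matrix `A = B D H D'`, where `s` and `s'` are the diagonals of `D` and `D'`. -/
def jlMatrix {k n : ℕ} (B : Matrix (Fin k) (Fin (2 ^ n)) ℝ) (s s' : Fin (2 ^ n) → ℝ) :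
    Matrix (Fin k) (Fin (2 ^ n)) ℝ :=
  B * Matrix.diagonal s * walshHadamard n * Matrix.diagonal s'

/-- A Rademacher sequence: independent random variables that are `1` or `-1` with
probability `1/2` each. -/
def IsRademacher {Ω ι : Type*} [MeasurableSpace Ω] (P : Measure Ω) (ξ : ι → Ω → ℝ) : Prop :=
  (∀ i, Measurable (ξ i)) ∧ iIndepFun ξ P ∧
    ∀ i, P {ω | ξ i ω = 1} = 1 / 2 ∧ P {ω | ξ i ω = -1} = 1 / 2

/-- One step of a computation with real registers, numbered by `ℕ`: the sum or the difference
of two registers, or a real constant times a register, is written to the register `dst`. -/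
inductive Instr where
  | add (dst a b : ℕ) : Instr
  | sub (dst a b : ℕ) : Instr
  | smul (dst : ℕ) (c : ℝ) (a : ℕ) : Instr

/-- The effect of one instruction on the registers. -/
def Instr.exec : Instr → (ℕ → ℝ) → (ℕ → ℝ)
  | .add dst a b, σ => Function.update σ dst (σ a + σ b)
  | .sub dst a b, σ => Function.update σ dst (σ a - σ b)
  | .smul dst c a, σ => Function.update σ dst (c * σ a)

/-- The registers after the execution of a straight-line program, one instruction after
the other. -/
def run (p : List Instr) (σ : ℕ → ℝ) : ℕ → ℝ :=
  p.foldl (fun τ c => c.exec τ) σ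

/-- The initial registers: the input in the registers `0, …, d - 1`, and `0` elsewhere. -/
def input {d : ℕ} (x : Fin d → ℝ) : ℕ → ℝ :=
  fun i => if h : i < d then x ⟨i, h⟩ else 0

/-- The map `f : ℝ ^ d → ℝ ^ k` can be computed in time `T`: one straight-line program with at
most `T` arithmetic operations leaves, for every input `x`, the coordinates of `f x` in
prescribed registers. -/
def ComputableInTime {d k : ℕ} (f : (Fin d → ℝ) → (Fin k → ℝ)) (T : ℝ) : Prop :=
  ∃ (p : List Instr) (out : Fin k → ℕ), (p.length : ℝ) ≤ T ∧
    ∀ x i, run p (input x) (out i) = f x i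

end

end FastJL

namespace FastJL

open Finset
open scoped BigOperators

/-! Tail bound. Fix the signs in `D'`, let `w = D' x` and `y = H w`. Then `A x = B D y` is a
Rademacher sum with matrix `B i j * y j`, whose Frobenius norm is 1 because the columns of `B` are
unit vectors. Cauchy–Schwarz and the fourth moments of 4-wise independent rows bound its squared
operator norm by `L = 3 √N / k`, where `N = d ∑ y j ^ 4` is `fourth` of `w`
(`IsFourWiseIndependent.operator_bound`). A Hanson–Wright argument (`expect_norm_deviation_le`) then
bounds the probability of a deviation above `t` by `2 exp (-t² / (64 L))`.

The randomness of `D'` keeps `N` small: `E N ^ p ≤ (K p) ^ p` (`expect_fourth_pow_le`), so `N ≤ K e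
p` outside an event of probability `e ^ (-p)`. For `p` close to `r = k ^ (2/3) t ^ (4/3)` both error
terms balance, since `t² k / √r = r`. The moments of `N` come from decoupling: with half of the
signs fixed, the decoupled form is the squared norm of a Rademacher sum whose operator bound
involves only `√N` of the fixed half. This gives a recursion for the moments with a square root on
the right, which closes on itself when `x` has no large coordinates; the large ones are bounded
deterministically.

Running time. Take rows of `H` that depend on only `l` digits of the column number, with `2 ^ l` of
order `k²`; the columns `(α, α³)` of a BCH parity check matrix supply 4-wise independent ones. As
`H` is a tensor product, the transform in the remaining digits merges with `D` into constants that
do not depend on the input. What is left are two fast transforms in `l` digits and `O(d)` further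
operations (`hasProgram_jlMatrix`). If `d < 4 k²`, then `log d = O(log k)` and any 4-wise
independent code matrix will do. -/

/-- The real sign attached to a bit. -/
def sgn (b : Bool) : ℝ := if b then -1 else 1

@[simp] lemma sgn_mul_self (b : Bool) : sgn b * sgn b = 1 := by cases b <;> simp [sgn]

@[simp] lemma sgn_sq (b : Bool) : sgn b ^ 2 = 1 := by cases b <;> simp [sgn]

/-! ### Averages over uniform sign patterns. -/

section Signs

variable {ι κ : Type*} [Fintype ι] [DecidableEq ι]

lemma expect_prod_apply (f : ι → Bool → ℝ) :
    𝔼 s : ι → Bool, ∏ i, f i (s i) = ∏ i, 𝔼 b, f i b := by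
  simp only [Fintype.expect_eq_sum_div_card, Finset.prod_div_distrib]
  rw [Finset.prod_univ_sum, Fintype.piFinset_univ]
  simp

lemma expect_exp_linear_le (h : ι → ℝ) :
    𝔼 s : ι → Bool, Real.exp (∑ i, h i * sgn (s i)) ≤ Real.exp ((∑ i, h i ^ 2) / 2) := by
  simp only [Real.exp_sum]
  rw [expect_prod_apply fun i b => Real.exp (h i * sgn b), Finset.sum_div, Real.exp_sum]
  refine Finset.prod_le_prod (fun i _ => Finset.expect_nonneg fun b _ => (Real.exp_pos _).le)
    fun i _ => ?_
  refine le_trans (le_of_eq ?_) (Real.cosh_le_exp_half_sq (h i))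
  rw [Fintype.expect_eq_sum_div_card, Real.cosh_eq]
  simp [sgn]
  ring

lemma expect_sgn_mul_sgn (i j : ι) :
    𝔼 s : ι → Bool, sgn (s i) * sgn (s j) = if i = j then 1 else 0 := by
  split_ifs with h
  · subst h; simp
  · have key : ∀ s : ι → Bool, sgn (s i) * sgn (s j) =
        ∏ l, (if l = i ∨ l = j then sgn (s l) else 1) := by
      intro s
      rw [Finset.prod_ite, Finset.prod_const_one, mul_one, Finset.filter_or,
        Finset.filter_eq' , Finset.filter_eq']
      simp [h]
    simp only [key]
    rw [expect_prod_apply fun l b => if l = i ∨ l = j then sgn b else 1]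
    apply Finset.prod_eq_zero (Finset.mem_univ i)
    rw [Fintype.expect_eq_sum_div_card]
    simp [sgn]

lemma expect_sq_linear (c : ι → ℝ) :
    𝔼 s : ι → Bool, (∑ i, c i * sgn (s i)) ^ 2 = ∑ i, c i ^ 2 := by
  have : ∀ s : ι → Bool, (∑ i, c i * sgn (s i)) ^ 2 =
      ∑ i, ∑ j, (c i * c j) * (sgn (s i) * sgn (s j)) := by
    intro s
    rw [sq, Finset.sum_mul_sum]
    exact Finset.sum_congr rfl fun i _ => Finset.sum_congr rfl fun j _ => by ring
  simp only [this, Finset.expect_sum_comm, ← Finset.mul_expect, expect_sgn_mul_sgn]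
  simp [sq]

/-- Combine two sign patterns along a set of coordinates. -/
def mix (δ s s' : ι → Bool) : ι → Bool := fun i => if δ i then s i else s' i

/-- Exchanging the coordinates outside `δ` between two independent uniform patterns is an
involution, so the mixture is again uniform. This allows one half of the signs to be fixed after
decoupling. -/
lemma expect_mix (δ : ι → Bool) (f : (ι → Bool) → ℝ) :
    𝔼 s : ι → Bool, f s = 𝔼 s' : ι → Bool, 𝔼 s : ι → Bool, f (mix δ s s') := by
  have hinv : Function.Involutive
      (fun q : (ι → Bool) × (ι → Bool) => (mix δ q.1 q.2, mix δ q.2 q.1)) := by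
    rintro ⟨s, s'⟩
    ext i <;> simp [mix] <;> split_ifs <;> rfl
  have h1 : 𝔼 q : (ι → Bool) × (ι → Bool), f (mix δ q.1 q.2) =
      𝔼 q : (ι → Bool) × (ι → Bool), f q.1 :=
    Fintype.expect_equiv hinv.toPerm _ _ fun q => rfl
  rw [← Finset.univ_product_univ, Finset.expect_product, Finset.expect_product] at h1
  rw [Finset.expect_comm, h1]
  simp

end Signs

/-! ### Cauchy–Schwarz, Markov and Jensen inequalities for finite averages. -/

section Jensen

variable {ι : Type*} [Fintype ι]

lemma expect_mul_le_sqrt_mul_sqrt (f g : ι → ℝ) :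
    𝔼 i, f i * g i ≤ √(𝔼 i, f i ^ 2) * √(𝔼 i, g i ^ 2) := by
  rw [← Real.sqrt_mul (Finset.expect_nonneg fun i _ => sq_nonneg _)]
  exact Real.le_sqrt_of_sq_le (Finset.expect_mul_sq_le_sq_mul_sq _ _ _)

/-- Markov's inequality for exponential moments. -/
lemma expect_indicator_le_exp (f : ι → ℝ) (q : ι → Prop) [DecidablePred q] (c : ℝ)
    (h : ∀ i, q i → c ≤ f i) :
    𝔼 i, (if q i then (1 : ℝ) else 0) ≤ Real.exp (-c) * 𝔼 i, Real.exp (f i) := by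
  rw [Finset.mul_expect]
  refine Finset.expect_le_expect fun i _ => ?_
  rw [← Real.exp_add]
  split_ifs with hi
  · exact Real.one_le_exp (by linarith [h i hi])
  · positivity

variable [Nonempty ι]

lemma map_expect_le {g : ℝ → ℝ} {D : Set ℝ} (hg : ConvexOn ℝ D g) (f : ι → ℝ)
    (hf : ∀ i, f i ∈ D) : g (𝔼 i, f i) ≤ 𝔼 i, g (f i) := by
  have := hg.map_sum_le (t := Finset.univ) (w := fun _ : ι => ((Fintype.card ι : ℝ))⁻¹) (p := f)
    (fun _ _ => by positivity) (by simp) (fun i _ => hf i)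
  simpa [Fintype.expect_eq_sum_div_card, div_eq_inv_mul, Finset.mul_sum] using this

lemma exp_expect_le (f : ι → ℝ) : Real.exp (𝔼 i, f i) ≤ 𝔼 i, Real.exp (f i) :=
  map_expect_le convexOn_exp f fun _ => Set.mem_univ _

lemma expect_pow_le (p : ℕ) (f : ι → ℝ) (hf : ∀ i, 0 ≤ f i) :
    (𝔼 i, f i) ^ p ≤ 𝔼 i, f i ^ p :=
  map_expect_le (convexOn_pow p) f hf

lemma expect_sq_le (f : ι → ℝ) : (𝔼 i, f i) ^ 2 ≤ 𝔼 i, f i ^ 2 :=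
  map_expect_le (even_two.convexOn_pow) f fun _ => Set.mem_univ _

lemma expect_sqrt_le (f : ι → ℝ) (hf : ∀ i, 0 ≤ f i) :
    𝔼 i, √(f i) ≤ √(𝔼 i, f i) := by
  apply Real.le_sqrt_of_sq_le
  refine (expect_sq_le _).trans (le_of_eq ?_)
  exact Finset.expect_congr rfl fun i _ => Real.sq_sqrt (hf i)

end Jensen

/-! ### Exponential moments of a standard Gaussian and of its square. -/

section Gaussian

lemma integral_exp_mul_gaussianReal (t : ℝ) :
    ∫ g, Real.exp (t * g) ∂(gaussianReal 0 1) = Real.exp (t ^ 2 / 2) := by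
  have := mgf_gaussianReal (p := gaussianReal 0 1) (X := id) (μ := 0) (v := 1) (by simp) t
  simpa [mgf] using this

lemma integrable_exp_mul_sq_gaussianReal {θ : ℝ} (hθ : θ ≤ 1 / 4) :
    Integrable (fun g => Real.exp (θ * g ^ 2)) (gaussianReal 0 1) := by
  rw [gaussianReal_of_var_ne_zero _ one_ne_zero, gaussianPDF_def,
    integrable_withDensity_iff_integrable_smul' (by fun_prop) (by simp)]
  have := ((integrable_exp_neg_mul_sq (b := 1 / 2 - θ) (by linarith)).const_mul (√(2 * Real.pi))⁻¹)
  refine this.congr (Filter.Eventually.of_forall fun x => ?_)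
  simp only [gaussianPDFReal, smul_eq_mul]
  rw [ENNReal.toReal_ofReal (by positivity)]
  simp only [NNReal.coe_one, mul_one, sub_zero]
  rw [mul_assoc, ← Real.exp_add]
  congr 2
  ring

lemma integral_exp_mul_sq_gaussianReal_le {θ : ℝ} (h0 : 0 ≤ θ) (hθ : θ ≤ 1 / 4) :
    ∫ g, Real.exp (θ * g ^ 2) ∂(gaussianReal 0 1) ≤ Real.exp (2 * θ) := by
  rw [integral_gaussianReal_eq_integral_smul one_ne_zero]
  have e : ∀ x : ℝ, gaussianPDFReal 0 1 x • Real.exp (θ * x ^ 2) =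
      (√(2 * Real.pi))⁻¹ * Real.exp (-(1 / 2 - θ) * x ^ 2) := by
    intro x
    simp only [gaussianPDFReal, smul_eq_mul, NNReal.coe_one, mul_one, sub_zero]
    rw [mul_assoc, ← Real.exp_add]
    congr 2
    ring
  simp only [e]
  rw [integral_const_mul, integral_gaussian, ← Real.sqrt_inv, ← Real.sqrt_mul (by positivity),
    Real.sqrt_le_left (by positivity), ← Real.exp_nat_mul]
  have hπ := Real.pi_pos
  have h1 : (2 * Real.pi)⁻¹ * (Real.pi / (1 / 2 - θ)) = 1 / (1 - 2 * θ) := by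
    have : (1 / 2 - θ) ≠ 0 := by linarith
    have : (1 - 2 * θ) ≠ 0 := by linarith
    field_simp
  rw [h1]
  -- `1 / (1 - 2θ) ≤ 1 + 4θ` holds exactly in the range `0 ≤ θ ≤ 1/4` among `θ` in `[0, 1/2)`.
  have h2 := Real.add_one_le_exp ((2 : ℕ) * (2 * θ))
  refine le_trans ?_ h2
  rw [div_le_iff₀ (by linarith)]
  push_cast
  nlinarith

end Gaussian

/-! ### Exponential moments of squared norms of Rademacher sums. -/

section Mgf

variable {ι κ : Type*} [Fintype ι] [DecidableEq ι] [Fintype κ]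

/-- Diagonalisation of the quadratic form `u ↦ ‖N u‖ ^ 2`. -/
lemma exists_diagonalization (N : Matrix κ ι ℝ) :
    ∃ (U : ι → ι → ℝ) (l : ι → ℝ),
      (∀ r q, ∑ a, U r a * U q a = if r = q then 1 else 0) ∧
      (∀ u : ι → ℝ, ∑ i, (∑ a, N i a * u a) ^ 2 = ∑ r, l r * (∑ a, U r a * u a) ^ 2) ∧
      (∑ r, l r = ∑ i, ∑ a, N i a ^ 2) := by
  have hA : (N.transpose * N).IsHermitian := by
    rw [Matrix.IsHermitian, Matrix.conjTranspose_eq_transpose_of_trivial]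
    simp
  obtain ⟨V, hV⟩ : ∃ V : Matrix ι ι ℝ, V = ↑hA.eigenvectorUnitary := ⟨_, rfl⟩
  have hVV : V.transpose * V = 1 := by
    have := Matrix.mem_unitaryGroup_iff'.1 hA.eigenvectorUnitary.2
    rwa [Matrix.star_eq_conjTranspose, Matrix.conjTranspose_eq_transpose_of_trivial, ← hV] at this
  have hsp : N.transpose * N = V * Matrix.diagonal hA.eigenvalues * V.transpose := by
    have := hA.spectral_theorem
    rw [Unitary.conjStarAlgAut_apply, Matrix.star_eq_conjTranspose,
      Matrix.conjTranspose_eq_transpose_of_trivial, ← hV] at this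
    simpa [Function.comp_def] using this
  have htr := hA.trace_eq_sum_eigenvalues
  generalize hA.eigenvalues = l at hsp htr
  refine ⟨fun r a => V a r, l, ?_, ?_, ?_⟩
  · intro r q
    have := congrFun (congrFun hVV r) q
    simpa [Matrix.mul_apply, Matrix.one_apply] using this
  · intro u
    have h1 : ∑ i, (∑ a, N i a * u a) ^ 2 = dotProduct u ((N.transpose * N).mulVec u) := by
      rw [← Matrix.mulVec_mulVec, Matrix.dotProduct_mulVec, Matrix.vecMul_transpose]
      simp [dotProduct, Matrix.mulVec, sq]
    have h2 : ∀ r, ∑ a, V a r * u a = (V.transpose.mulVec u) r := by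
      intro r; simp [dotProduct, Matrix.mulVec]
    rw [h1, hsp, ← Matrix.mulVec_mulVec, ← Matrix.mulVec_mulVec, Matrix.dotProduct_mulVec,
      ← Matrix.mulVec_transpose]
    simp only [h2]
    simp only [dotProduct, Matrix.mulVec_diagonal]
    exact Finset.sum_congr rfl fun r _ => by ring
  · simp only [RCLike.ofReal_real_eq_id, id] at htr
    rw [← htr, Matrix.trace, Finset.sum_comm]
    simp [Matrix.mul_apply, sq]

/-- Exponential moments of the squared norm of a Rademacher sum. -/
theorem expect_exp_sq_norm_le (N : Matrix κ ι ℝ) {L μ : ℝ} (hμ : 0 ≤ μ)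
    (hL : ∀ u : ι → ℝ, ∑ i, (∑ a, N i a * u a) ^ 2 ≤ L * ∑ a, u a ^ 2) (hμL : μ * L ≤ 1 / 4) :
    𝔼 s : ι → Bool, Real.exp (μ * ∑ i, (∑ a, N i a * sgn (s a)) ^ 2) ≤
      Real.exp (2 * μ * ∑ i, ∑ a, N i a ^ 2) := by
  obtain ⟨U, l, hU, hq, htr⟩ := exists_diagonalization N
  have hlr : ∀ r, l r = ∑ i, (∑ a, N i a * U r a) ^ 2 := by
    intro r; rw [hq]; simp [hU]
  have hl0 : ∀ r, 0 ≤ l r := fun r => by rw [hlr]; positivity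
  have hlL : ∀ r, l r ≤ L := fun r => by
    rw [hlr]; refine (hL _).trans (le_of_eq ?_)
    have := hU r r
    simp only [← sq, if_true] at this
    rw [this, mul_one]
  -- Gaussian linearization: `exp (c² q² / 2)` is the mean of `exp (c q g)`, so each eigenvalue term
  -- `μ l_r q²` becomes linear in the signs at the price of a Gaussian variable `g_r`.
  set c : ι → ℝ := fun r => √(2 * μ * l r) with hc
  have hc2 : ∀ r, c r ^ 2 = 2 * μ * l r := fun r => Real.sq_sqrt (by have := hl0 r; positivity)
  set γ : Measure (ι → ℝ) := Measure.pi fun _ => gaussianReal 0 1 with hγ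
  set Q : (ι → Bool) → ι → ℝ := fun s r => ∑ a, U r a * sgn (s a) with hQ
  have hint : ∀ s, Integrable (fun g : ι → ℝ => ∏ r, Real.exp (c r * Q s r * g r)) γ := fun s =>
    Integrable.fintype_prod (f := fun r x => Real.exp (c r * Q s r * x))
      fun r => integrable_exp_mul_gaussianReal _
  have h1 : ∀ s, Real.exp (μ * ∑ i, (∑ a, N i a * sgn (s a)) ^ 2) =
      ∫ g, ∏ r, Real.exp (c r * Q s r * g r) ∂γ := by
    intro s
    rw [hγ, integral_fintype_prod_eq_prod (f := fun r x => Real.exp (c r * Q s r * x))]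
    simp only [integral_exp_mul_gaussianReal]
    rw [hq, ← Real.exp_sum, Finset.mul_sum]
    congr 1
    refine Finset.sum_congr rfl fun r _ => ?_
    rw [mul_pow, hc2]; ring
  have h2 : 𝔼 s : ι → Bool, Real.exp (μ * ∑ i, (∑ a, N i a * sgn (s a)) ^ 2) =
      ∫ g, 𝔼 s, ∏ r, Real.exp (c r * Q s r * g r) ∂γ := by
    simp only [h1, Fintype.expect_eq_sum_div_card]
    rw [integral_div, integral_finsetSum _ fun s _ => hint s]
  have hθ : ∀ r, μ * l r ≤ 1 / 4 := fun r =>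
    (mul_le_mul_of_nonneg_left (hlL r) hμ).trans hμL
  have hint2 : Integrable (fun g : ι → ℝ => ∏ r, Real.exp (μ * l r * g r ^ 2)) γ :=
    Integrable.fintype_prod (f := fun r x => Real.exp (μ * l r * x ^ 2))
      fun r => integrable_exp_mul_sq_gaussianReal (hθ r)
  -- For fixed Gaussians the average over signs is sub-Gaussian, and orthonormality of the rows of
  -- `U` makes the resulting quadratic form diagonal. The Gaussian integral then factors.
  have h3 : ∀ g : ι → ℝ, 𝔼 s, ∏ r, Real.exp (c r * Q s r * g r) ≤
      ∏ r, Real.exp (μ * l r * g r ^ 2) := by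
    intro g
    have e1 : ∀ s, ∏ r, Real.exp (c r * Q s r * g r) =
        Real.exp (∑ a, (∑ r, c r * g r * U r a) * sgn (s a)) := by
      intro s
      rw [← Real.exp_sum]
      congr 1
      simp only [hQ, Finset.mul_sum, Finset.sum_mul]
      rw [Finset.sum_comm]
      exact Finset.sum_congr rfl fun r _ => Finset.sum_congr rfl fun q _ => by ring
    simp only [e1]
    refine (expect_exp_linear_le _).trans (le_of_eq ?_)
    rw [← Real.exp_sum]
    congr 1
    have e2 : ∑ a, (∑ r, c r * g r * U r a) ^ 2 =
        ∑ r, ∑ q, (c r * g r * (c q * g q)) * ∑ a, U r a * U q a := by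
      have e3 : ∀ a, (∑ r, c r * g r * U r a) ^ 2 =
          ∑ r, ∑ q, (c r * g r * (c q * g q)) * (U r a * U q a) := fun a => by
        rw [sq, Finset.sum_mul_sum]
        exact Finset.sum_congr rfl fun r _ => Finset.sum_congr rfl fun q _ => by ring
      simp only [e3, Finset.mul_sum]
      rw [Finset.sum_comm]
      refine Finset.sum_congr rfl fun r _ => ?_
      rw [Finset.sum_comm]
    rw [e2]
    simp only [hU, mul_ite, mul_one, mul_zero, Finset.sum_ite_eq, Finset.mem_univ, if_true]
    rw [Finset.sum_div]
    refine Finset.sum_congr rfl fun r _ => ?_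
    have := hc2 r
    linear_combination (g r ^ 2 / 2) * this
  have hint3 : Integrable (fun g : ι → ℝ => 𝔼 s, ∏ r, Real.exp (c r * Q s r * g r)) γ := by
    simp only [Fintype.expect_eq_sum_div_card]
    exact (integrable_finsetSum _ fun s _ => hint s).div_const _
  rw [h2]
  refine (integral_mono hint3 hint2 h3).trans ?_
  rw [hγ, integral_fintype_prod_eq_prod (f := fun r x => Real.exp (μ * l r * x ^ 2)), ← htr,
    Finset.mul_sum, Real.exp_sum]
  refine Finset.prod_le_prod (fun r _ => integral_nonneg fun _ => (Real.exp_pos _).le)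
    fun r _ => ?_
  rw [mul_assoc]
  exact integral_exp_mul_sq_gaussianReal_le (mul_nonneg hμ (hl0 r)) (hθ r)

end Mgf

/-! ### Hanson–Wright concentration of the norm of a Rademacher sum. -/

section HansonWright

variable {ι κ : Type*} [Fintype ι] [Fintype κ]

/-- An operator bound for a matrix follows from the same bound for its transpose. -/
lemma sum_sq_mulVec_le_of_transpose {M : Matrix κ ι ℝ} {L : ℝ} (hL : 0 ≤ L)
    (hM : ∀ v : κ → ℝ, ∑ a, (∑ i, M i a * v i) ^ 2 ≤ L * ∑ i, v i ^ 2) (u : ι → ℝ) :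
    ∑ i, (∑ a, M i a * u a) ^ 2 ≤ L * ∑ a, u a ^ 2 := by
  set v : κ → ℝ := fun i => ∑ a, M i a * u a with hv
  have h1 : ∑ i, v i ^ 2 = ∑ a, (∑ i, M i a * v i) * u a := by
    have : ∀ i, v i ^ 2 = ∑ a, M i a * u a * v i := fun i => by
      rw [sq, ← Finset.sum_mul]
    simp only [this, Finset.sum_mul]
    rw [Finset.sum_comm]
    exact Finset.sum_congr rfl fun a _ => Finset.sum_congr rfl fun i _ => by ring
  have h2 : (∑ i, v i ^ 2) ^ 2 ≤ (L * ∑ i, v i ^ 2) * ∑ a, u a ^ 2 := by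
    nth_rewrite 1 [h1]
    refine (Finset.sum_mul_sq_le_sq_mul_sq _ _ _).trans ?_
    exact mul_le_mul_of_nonneg_right (hM v) (by positivity)
  have h3 : 0 ≤ ∑ i, v i ^ 2 := by positivity
  change ∑ i, v i ^ 2 ≤ _
  rcases h3.eq_or_lt with h | h
  · rw [← h]; positivity
  · nlinarith

variable [DecidableEq ι]

lemma expect_sgn (i : ι) : 𝔼 s : ι → Bool, sgn (s i) = 0 := by
  have key : ∀ s : ι → Bool, sgn (s i) = ∏ l, (if l = i then sgn (s l) else 1) := by
    intro s; simp
  simp only [key]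
  rw [expect_prod_apply fun l b => if l = i then sgn b else 1]
  apply Finset.prod_eq_zero (Finset.mem_univ i)
  rw [Fintype.expect_eq_sum_div_card]
  simp [sgn]

/-- The indicator of a bit. -/
def ind (b : Bool) : ℝ := if b then 1 else 0

lemma ind_eq (b : Bool) : ind b = (1 - sgn b) / 2 := by cases b <;> norm_num [ind, sgn]

lemma ind_not_eq (b : Bool) : ind (!b) = (1 + sgn b) / 2 := by cases b <;> norm_num [ind, sgn]

lemma ind_nonneg (b : Bool) : 0 ≤ ind b := by cases b <;> simp [ind]

lemma ind_le_one (b : Bool) : ind b ≤ 1 := by cases b <;> simp [ind]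

lemma ind_sq_le_one (b : Bool) : ind b ^ 2 ≤ 1 := by cases b <;> simp [ind]

lemma expect_ind_mul_ind_not (a b : ι) :
    𝔼 δ : ι → Bool, ind (δ a) * ind (!δ b) = if a = b then 0 else 1 / 4 := by
  have : ∀ δ : ι → Bool, ind (δ a) * ind (!δ b) =
      1 / 4 + 1 / 4 * sgn (δ b) - 1 / 4 * sgn (δ a) - 1 / 4 * (sgn (δ a) * sgn (δ b)) := by
    intro δ; rw [ind_eq, ind_not_eq]; ring
  simp only [this, Finset.expect_sub_distrib, Finset.expect_add_distrib, ← Finset.mul_expect,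
    expect_sgn, expect_sgn_mul_sgn, Fintype.expect_const]
  split_ifs <;> norm_num

/-- Exponential moments of the off-diagonal part of the quadratic form `‖M ε‖ ^ 2`. -/
lemma expect_exp_offdiag_le {M : Matrix κ ι ℝ} {L F : ℝ} (hL : 0 ≤ L)
    (hM : ∀ v : κ → ℝ, ∑ a, (∑ i, M i a * v i) ^ 2 ≤ L * ∑ i, v i ^ 2)
    (hF : ∑ i, ∑ a, M i a ^ 2 = F) {l : ℝ} (hl : 32 * l ^ 2 * L ^ 2 ≤ 1) :
    𝔼 s : ι → Bool, Real.exp (l * (∑ i, (∑ a, M i a * sgn (s a)) ^ 2 - F)) ≤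
      Real.exp (16 * l ^ 2 * (L * F)) := by
  set G : ι → ι → ℝ := fun a b => ∑ i, M i a * M i b with hG
  have hGv : ∀ u : ι → ℝ, ∑ a, (∑ b, G a b * u b) ^ 2 ≤ L ^ 2 * ∑ a, u a ^ 2 := by
    intro u
    have e : ∀ a, ∑ b, G a b * u b = ∑ i, M i a * ∑ b, M i b * u b := by
      intro a
      simp only [hG, Finset.sum_mul, Finset.mul_sum]
      rw [Finset.sum_comm]
      exact Finset.sum_congr rfl fun i _ => Finset.sum_congr rfl fun b _ => by ring
    simp only [e]
    refine (hM _).trans ?_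
    rw [sq, mul_assoc]
    exact mul_le_mul_of_nonneg_left (sum_sq_mulVec_le_of_transpose hL hM u) hL
  have hGF : ∑ a, ∑ b, G a b ^ 2 ≤ L * F := by
    rw [Finset.sum_comm, ← hF, Finset.sum_comm (f := fun i a => M i a ^ 2), Finset.mul_sum]
    refine Finset.sum_le_sum fun b _ => ?_
    exact hM fun i => M i b
  -- Decoupling by random selectors: the weight has mean `1/4` off the diagonal and `0` on it, while
  -- the diagonal of the form is the constant `F`. Hence the centred form is `4 𝔼 δ, Qd δ s`.
  set Qd : (ι → Bool) → (ι → Bool) → ℝ := fun δ s =>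
    ∑ a, ∑ b, (ind (δ a) * ind (!δ b)) * (G a b * (sgn (s a) * sgn (s b))) with hQd
  have hdec : ∀ s : ι → Bool, ∑ i, (∑ a, M i a * sgn (s a)) ^ 2 - F = 4 * 𝔼 δ, Qd δ s := by
    intro s
    have e1 : ∑ i, (∑ a, M i a * sgn (s a)) ^ 2 = ∑ a, ∑ b, G a b * (sgn (s a) * sgn (s b)) := by
      simp only [hG, Finset.sum_mul, sq, Finset.mul_sum]
      rw [Finset.sum_comm]
      simp only [Finset.sum_comm (s := (Finset.univ : Finset κ))]
      rw [Finset.sum_comm]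
      exact Finset.sum_congr rfl fun a _ => Finset.sum_congr rfl fun b _ =>
        Finset.sum_congr rfl fun i _ => by ring
    have e2 : F = ∑ a, ∑ b, if a = b then G a b * (sgn (s a) * sgn (s b)) else 0 := by
      simp only [Finset.sum_ite_eq, Finset.mem_univ, if_true, hG, ← sq, sgn_sq, mul_one]
      rw [← hF, Finset.sum_comm]
    rw [e1, e2, ← Finset.sum_sub_distrib]
    simp only [hQd, Finset.expect_sum_comm, ← Finset.expect_mul, expect_ind_mul_ind_not,
      Finset.mul_sum, ← Finset.sum_sub_distrib]
    refine Finset.sum_congr rfl fun a _ => Finset.sum_congr rfl fun b _ => ?_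
    split_ifs <;> ring
  have hδ : ∀ δ : ι → Bool, 𝔼 s, Real.exp (4 * l * Qd δ s) ≤ Real.exp (16 * l ^ 2 * (L * F)) := by
    intro δ
    rw [expect_mix δ]
    set N : Matrix ι ι ℝ := fun a b => ind (δ a) * ind (!δ b) * G a b with hN
    -- Only the selected coordinates of `s` and the unselected ones of `s'` enter, so the form is
    -- linear in `s` once `s'` is fixed.
    have hQ : ∀ s' s : ι → Bool, 4 * l * Qd δ (mix δ s s') =
        ∑ a, (4 * l * ∑ b, N a b * sgn (s' b)) * sgn (s a) := by
      intro s' s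
      simp only [hQd, hN, Finset.mul_sum, Finset.sum_mul]
      refine Finset.sum_congr rfl fun a _ => Finset.sum_congr rfl fun b _ => ?_
      by_cases ha : δ a = true <;> by_cases hb : δ b = true <;> simp [mix, ha, hb, ind]
      ring
    have hNL : ∀ u : ι → ℝ, ∑ a, (∑ b, N a b * u b) ^ 2 ≤ L ^ 2 * ∑ b, u b ^ 2 := by
      intro u
      calc ∑ a, (∑ b, N a b * u b) ^ 2
          = ∑ a, ind (δ a) ^ 2 * (∑ b, G a b * (ind (!δ b) * u b)) ^ 2 := by
            refine Finset.sum_congr rfl fun a _ => ?_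
            rw [← mul_pow, Finset.mul_sum]
            congr 1
            exact Finset.sum_congr rfl fun b _ => by simp only [hN]; ring
        _ ≤ ∑ a, (∑ b, G a b * (ind (!δ b) * u b)) ^ 2 :=
            Finset.sum_le_sum fun a _ =>
              mul_le_of_le_one_left (sq_nonneg _) (ind_sq_le_one _)
        _ ≤ _ := hGv _
        _ ≤ _ := by
            refine mul_le_mul_of_nonneg_left (Finset.sum_le_sum fun b _ => ?_) (sq_nonneg L)
            rw [mul_pow]
            exact mul_le_of_le_one_left (sq_nonneg _) (ind_sq_le_one _)
    have hNF : ∑ a, ∑ b, N a b ^ 2 ≤ L * F := by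
      refine le_trans (Finset.sum_le_sum fun a _ => Finset.sum_le_sum fun b _ => ?_) hGF
      simp only [hN]
      rw [mul_pow, mul_pow]
      refine mul_le_of_le_one_left (sq_nonneg _) ?_
      exact mul_le_one₀ (ind_sq_le_one _) (sq_nonneg _) (ind_sq_le_one _)
    -- The sub-Gaussian bound in `s` costs `(4 l)² / 2 = 8 l²`; the remaining squared norm in `s'`
    -- has operator bound `L²`, and `hl` is precisely `8 l² L² ≤ 1/4`.
    calc 𝔼 s', 𝔼 s, Real.exp (4 * l * Qd δ (mix δ s s'))
        ≤ 𝔼 s' : ι → Bool, Real.exp (8 * l ^ 2 * ∑ a, (∑ b, N a b * sgn (s' b)) ^ 2) := by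
          refine Finset.expect_le_expect fun s' _ => ?_
          simp only [hQ]
          refine (expect_exp_linear_le _).trans (le_of_eq ?_)
          congr 1
          simp only [mul_pow, ← Finset.mul_sum]
          ring
      _ ≤ Real.exp (2 * (8 * l ^ 2) * ∑ a, ∑ b, N a b ^ 2) :=
          expect_exp_sq_norm_le N (by positivity) hNL (by linarith)
      _ ≤ _ := by
          apply Real.exp_le_exp.2
          have := mul_le_mul_of_nonneg_left hNF (by positivity : 0 ≤ 16 * l ^ 2)
          linarith
  calc 𝔼 s : ι → Bool, Real.exp (l * (∑ i, (∑ a, M i a * sgn (s a)) ^ 2 - F))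
      ≤ 𝔼 s : ι → Bool, 𝔼 δ : ι → Bool, Real.exp (4 * l * Qd δ s) := by
        refine Finset.expect_le_expect fun s _ => ?_
        refine le_trans (le_of_eq ?_) (exp_expect_le _)
        rw [hdec, ← Finset.mul_expect]
        congr 1; ring
    _ = 𝔼 δ : ι → Bool, 𝔼 s : ι → Bool, Real.exp (4 * l * Qd δ s) := Finset.expect_comm _ _ _
    _ ≤ _ := Finset.expect_le Finset.univ_nonempty fun δ _ => hδ δ

open Classical in
/-- Concentration of the norm of a Rademacher sum around its root mean square. -/
theorem expect_norm_deviation_le {M : Matrix κ ι ℝ} {L : ℝ} (hL : 0 < L)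
    (hM : ∀ v : κ → ℝ, ∑ a, (∑ i, M i a * v i) ^ 2 ≤ L * ∑ i, v i ^ 2)
    (hF : ∑ i, ∑ a, M i a ^ 2 = 1) {t : ℝ} (ht : 0 < t) :
    𝔼 s : ι → Bool, (if |√(∑ i, (∑ a, M i a * sgn (s a)) ^ 2) - 1| > t then (1 : ℝ) else 0) ≤
      2 * Real.exp (-(t ^ 2 / (64 * L))) := by
  set Z : (ι → Bool) → ℝ := fun s => ∑ i, (∑ a, M i a * sgn (s a)) ^ 2 with hZ
  have hZ0 : ∀ s, 0 ≤ Z s := fun s => by positivity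
  -- The exponent `-l c + 16 l² L` is minimal at `l = c / (32 L)`, and `l L` must stay bounded; `m`
  -- replaces `c` and caps it at 1.
  set m := min t 1 with hm
  have hm0 : 0 < m := lt_min ht one_pos
  have hm1 : m ≤ 1 := min_le_right _ _
  have hmt : m ≤ t := min_le_left _ _
  set l := m / (32 * L) with hl
  have hl0 : 0 < l := by positivity
  have hlL : l * L = m / 32 := by rw [hl]; field_simp
  have hl2 : 32 * l ^ 2 * L ^ 2 ≤ 1 := by
    have : l ^ 2 * L ^ 2 = (m / 32) ^ 2 := by rw [← hlL]; ring
    nlinarith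
  have hm2 : t ^ 2 ≤ m * (t + 2 * t ^ 2) := by
    rcases le_total t 1 with h | h
    · rw [hm, min_eq_left h]; nlinarith [pow_pos ht 3]
    · rw [hm, min_eq_right h]; nlinarith
  have hexp : ∀ c : ℝ, m * (2 * c - m) ≥ t ^ 2 →
      -(l * c) + 16 * l ^ 2 * (L * 1) ≤ -(t ^ 2 / (64 * L)) := by
    intro c hc
    have e : -(l * c) + 16 * l ^ 2 * (L * 1) = -(m * (2 * c - m) / (64 * L)) := by
      rw [hl]; field_simp; ring
    rw [e, neg_le_neg_iff]
    gcongr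
  have hup : 𝔼 s : ι → Bool, (if √(Z s) > 1 + t then (1 : ℝ) else 0) ≤
      Real.exp (-(t ^ 2 / (64 * L))) := by
    -- `√Z > 1 + t` gives `Z - 1 > 2t + t²`; the weaker `t + t²` is enough for both small and large
    -- `t`.
    refine (expect_indicator_le_exp (fun s => l * (Z s - 1)) _ (l * (t + t ^ 2)) ?_).trans ?_
    · intro s hs
      refine mul_le_mul_of_nonneg_left ?_ hl0.le
      have := Real.sq_sqrt (hZ0 s)
      nlinarith
    · refine (mul_le_mul_of_nonneg_left (expect_exp_offdiag_le hL.le hM hF hl2)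
        (Real.exp_pos _).le).trans ?_
      rw [← Real.exp_add]
      refine Real.exp_le_exp.2 (hexp _ ?_)
      nlinarith
  have hlow : 𝔼 s : ι → Bool, (if √(Z s) < 1 - t then (1 : ℝ) else 0) ≤
      Real.exp (-(t ^ 2 / (64 * L))) := by
    by_cases ht1 : 1 ≤ t
    · have : ∀ s, ¬ √(Z s) < 1 - t := fun s => by
        have := Real.sqrt_nonneg (Z s); linarith
      simp only [this, if_false, Fintype.expect_const]
      positivity
    · push Not at ht1
      refine (expect_indicator_le_exp (fun s => -l * (Z s - 1)) _ (l * t) ?_).trans ?_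
      · intro s hs
        have := Real.sq_sqrt (hZ0 s)
        have h0 := Real.sqrt_nonneg (Z s)
        have : t ≤ 1 - Z s := by nlinarith
        have := mul_le_mul_of_nonneg_left this hl0.le
        linarith
      · refine (mul_le_mul_of_nonneg_left (expect_exp_offdiag_le hL.le hM hF (l := -l) ?_)
          (Real.exp_pos _).le).trans ?_
        · rw [neg_sq]; exact hl2
        · rw [← Real.exp_add, neg_sq]
          refine Real.exp_le_exp.2 (hexp _ ?_)
          have : m = t := min_eq_left ht1.le
          rw [this]; nlinarith
  calc _ ≤ 𝔼 s : ι → Bool, ((if √(Z s) > 1 + t then (1 : ℝ) else 0) +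
          (if √(Z s) < 1 - t then (1 : ℝ) else 0)) := by
        refine Finset.expect_le_expect fun s _ => ?_
        by_cases h1 : √(Z s) > 1 + t
        · rw [if_pos h1]
          split_ifs <;> norm_num
        · by_cases h2 : √(Z s) < 1 - t
          · rw [if_pos h2]
            split_ifs <;> norm_num
          · rw [if_neg h1, if_neg h2, if_neg, add_zero]
            rw [not_lt, abs_le]
            constructor <;> linarith
    _ ≤ _ := by
        rw [Finset.expect_add_distrib]; linarith

end HansonWright

/-! ### Moments of the fourth-power mean of the transform of a randomly signed vector. -/

section Moments

lemma add_pow_le_two_pow_mul {a b : ℝ} (ha : 0 ≤ a) (hb : 0 ≤ b) (p : ℕ) :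
    (a + b) ^ p ≤ 2 ^ p * (a ^ p + b ^ p) :=
  (add_pow_le ha hb p).trans <| mul_le_mul_of_nonneg_right
    (pow_le_pow_right₀ one_le_two (Nat.sub_le _ _)) (by positivity)

variable {ι κ : Type*} [Fintype ι] [DecidableEq ι] [Fintype κ]

/-- From `W ^ p ≤ p! μ ^ (-p) exp (μ W)` and the exponential moment bound. The choice `μ = p / (1 +
4 p L)` ensures `μ L ≤ 1/4`, as that bound requires, and `μ ≤ p`, which keeps the exponential factor
below `exp (2 p)`. -/
lemma expect_sq_norm_pow_le (N : Matrix κ ι ℝ) {L : ℝ} (hL0 : 0 ≤ L)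
    (hL : ∀ u : ι → ℝ, ∑ i, (∑ a, N i a * u a) ^ 2 ≤ L * ∑ a, u a ^ 2)
    (hF : ∑ i, ∑ a, N i a ^ 2 ≤ 1) {p : ℕ} (hp : 1 ≤ p) :
    𝔼 s : ι → Bool, (∑ i, (∑ a, N i a * sgn (s a)) ^ 2) ^ p ≤
      (Real.exp 2 * (1 + 4 * p * L)) ^ p := by
  have hp0 : (0 : ℝ) < p := by exact_mod_cast hp
  have hd : 0 < 1 + 4 * p * L := by positivity
  set μ : ℝ := p / (1 + 4 * p * L) with hμ
  have hμ0 : 0 < μ := by positivity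
  have hμp : μ ≤ p := div_le_self hp0.le (by linarith [mul_nonneg (by positivity : 0 ≤ 4 * (p : ℝ)) hL0])
  have hμL : μ * L ≤ 1 / 4 := by
    rw [hμ, div_mul_eq_mul_div, div_le_iff₀ hd]; nlinarith
  have hpμ : (p : ℝ) / μ = 1 + 4 * p * L := by rw [hμ]; field_simp
  have key : ∀ W : ℝ, 0 ≤ W → W ^ p ≤ (1 + 4 * p * L) ^ p * Real.exp (μ * W) := by
    intro W hW
    have h1 := Real.pow_div_factorial_le_exp (μ * W) (by positivity) p
    have h2 : (p.factorial : ℝ) ≤ (p : ℝ) ^ p := by exact_mod_cast Nat.factorial_le_pow p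
    rw [div_le_iff₀ (by positivity)] at h1
    have h3 : (μ * W) ^ p ≤ Real.exp (μ * W) * (p : ℝ) ^ p :=
      h1.trans (mul_le_mul_of_nonneg_left h2 (Real.exp_pos _).le)
    rw [← hpμ, div_pow, div_mul_eq_mul_div, le_div_iff₀ (by positivity), mul_comm (W ^ p),
      ← mul_pow, mul_comm ((p : ℝ) ^ p)]
    exact h3
  calc _ ≤ 𝔼 s : ι → Bool, (1 + 4 * p * L) ^ p *
          Real.exp (μ * ∑ i, (∑ a, N i a * sgn (s a)) ^ 2) :=
        Finset.expect_le_expect fun s _ => key _ (by positivity)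
    _ ≤ (1 + 4 * p * L) ^ p * Real.exp (2 * p) := by
        rw [← Finset.mul_expect]
        refine mul_le_mul_of_nonneg_left ((expect_exp_sq_norm_le N hμ0.le hL hμL).trans ?_)
          (by positivity)
        refine Real.exp_le_exp.2 ?_
        have : 0 ≤ ∑ i, ∑ a, N i a ^ 2 := by positivity
        nlinarith
    _ = _ := by
        rw [mul_pow, mul_comm 2 (p : ℝ), Real.exp_nat_mul, mul_comm]

/-- A pointwise decoupling: `∑ c²` is the mean of `(∑ ± c)²`, and the difference of squares `(∑ c)²
- (∑ ± c)²` is four times the product of the sums over the two halves. Jensen moves the outer square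
inside. -/
lemma sq_sub_sum_sq_sq_le (c : ι → ℝ) :
    ((∑ a, c a) ^ 2 - ∑ a, c a ^ 2) ^ 2 ≤
      16 * 𝔼 δ : ι → Bool, (∑ a, ind (δ a) * c a) ^ 2 * (∑ a, ind (!δ a) * c a) ^ 2 := by
  have h1 : (∑ a, c a) ^ 2 - ∑ a, c a ^ 2 =
      𝔼 δ : ι → Bool, ((∑ a, c a) ^ 2 - (∑ a, c a * sgn (δ a)) ^ 2) := by
    rw [Finset.expect_sub_distrib, expect_sq_linear, Fintype.expect_const]
  rw [h1, Finset.mul_expect]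
  refine (expect_sq_le _).trans (Finset.expect_le_expect fun δ _ => le_of_eq ?_)
  have e1 : ∑ a, ind (δ a) * c a = (∑ a, c a - ∑ a, c a * sgn (δ a)) / 2 := by
    rw [← Finset.sum_sub_distrib, Finset.sum_div]
    exact Finset.sum_congr rfl fun a _ => by rw [ind_eq]; ring
  have e2 : ∑ a, ind (!δ a) * c a = (∑ a, c a + ∑ a, c a * sgn (δ a)) / 2 := by
    rw [← Finset.sum_add_distrib, Finset.sum_div]
    exact Finset.sum_congr rfl fun a _ => by rw [ind_not_eq]; ring
  rw [e1, e2]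
  ring

/-- The properties of the sign kernel of an orthogonal matrix which control the fourth moments of
the image of a randomly signed vector. -/
structure IsFlatKernel (h : κ → ι → ℝ) : Prop where
  sq_eq_one : ∀ i a, h i a ^ 2 = 1
  parseval : ∀ w : ι → ℝ, 𝔼 i, (∑ a, h i a * w a) ^ 2 = ∑ a, w a ^ 2
  fourth_le : ∀ x u : ι → ℝ, 𝔼 i, (∑ a, h i a * (x a * u a)) ^ 4 ≤
    (∑ a, x a ^ 4) * (∑ a, u a ^ 2) ^ 2

/-- The mean fourth power of the coordinates of `h w`. -/
noncomputable def fourth (h : κ → ι → ℝ) (w : ι → ℝ) : ℝ := 𝔼 i, (∑ a, h i a * w a) ^ 4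

omit [DecidableEq ι] in
lemma fourth_nonneg (h : κ → ι → ℝ) (w : ι → ℝ) : 0 ≤ fourth h w :=
  Finset.expect_nonneg fun i _ => by positivity

omit [DecidableEq ι] in
lemma fourth_add_le (h : κ → ι → ℝ) (v w : ι → ℝ) :
    fourth h (v + w) ≤ 8 * (fourth h v + fourth h w) := by
  simp only [fourth, ← Finset.expect_add_distrib, Finset.mul_expect]
  refine Finset.expect_le_expect fun i _ => ?_
  have : ∑ a, h i a * (v + w) a = ∑ a, h i a * v a + ∑ a, h i a * w a := by
    rw [← Finset.sum_add_distrib]; exact Finset.sum_congr rfl fun a _ => by simp [mul_add]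
  rw [this]
  set A := ∑ a, h i a * v a
  set B := ∑ a, h i a * w a
  nlinarith [sq_nonneg (A - B), sq_nonneg (A ^ 2 - B ^ 2), mul_nonneg (sq_nonneg (A - B)) (sq_nonneg (A + B)),
    mul_nonneg (sq_nonneg (A - B)) (sq_nonneg A), mul_nonneg (sq_nonneg (A - B)) (sq_nonneg B),
    sq_nonneg ((A - B)^2)]

variable [Nonempty κ] {h : κ → ι → ℝ}

/-- For a coordinate `y` and `q = ∑ w²`, use `y⁴ ≤ 2 (y² - q)² + 2 q²`; the first term is decoupled
by `sq_sub_sum_sq_sq_le`, the second is at most 2. -/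
lemma fourth_le_decoupled (hh : IsFlatKernel h) {w : ι → ℝ} (hw : ∑ a, w a ^ 2 ≤ 1) :
    fourth h w ≤ 𝔼 δ : ι → Bool, (2 + 32 * 𝔼 i, (∑ a, ind (δ a) * (h i a * w a)) ^ 2 *
      (∑ a, ind (!δ a) * (h i a * w a)) ^ 2) := by
  have h0 : 0 ≤ ∑ a, w a ^ 2 := by positivity
  rw [Finset.expect_add_distrib, Fintype.expect_const, ← Finset.mul_expect, Finset.expect_comm,
    fourth, Finset.mul_expect, ← Fintype.expect_const (ι := κ) (2 : ℝ),
    ← Finset.expect_add_distrib]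
  refine Finset.expect_le_expect fun i _ => ?_
  have := sq_sub_sum_sq_sq_le fun a => h i a * w a
  simp only [mul_pow, hh.sq_eq_one, one_mul] at this
  set y := ∑ a, h i a * w a
  nlinarith [sq_nonneg (y ^ 2 - 2 * ∑ a, w a ^ 2)]

omit [DecidableEq ι] in
lemma sum_ind_mul_pow_le (δ : ι → Bool) (x : ι → ℝ) {n : ℕ} (hn : Even n) :
    ∑ a, (ind (δ a) * x a) ^ n ≤ ∑ a, x a ^ n := by
  refine Finset.sum_le_sum fun a _ => ?_
  rw [mul_pow]
  exact mul_le_of_le_one_left (hn.pow_nonneg _) (pow_le_one₀ (ind_nonneg _) (ind_le_one _))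

/-- With the signs outside `δ` fixed, the second factor is a weight `y i ^ 2` and the rest is a
Rademacher sum with matrix `y i * h i a * x a`, up to normalization. Cauchy–Schwarz over `i` and
`IsFlatKernel.fourth_le` bound its squared operator norm by `√(f s') * R`; Parseval bounds its
Frobenius norm by 1. Only the square root of `f` survives, which is what makes the recursion
contract. -/
lemma expect_decoupled_pow_le (hh : IsFlatKernel h) {x : ι → ℝ} (hx : ∑ a, x a ^ 2 ≤ 1) {R : ℝ}
    (hR : 0 ≤ R) (hxR : ∑ a, x a ^ 4 ≤ R ^ 2) {p : ℕ} (hp : 1 ≤ p) {S : ℝ} (δ : ι → Bool)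
    (hS : 𝔼 s : ι → Bool, fourth h (fun a => ind (!δ a) * x a * sgn (s a)) ^ p ≤ S) :
    𝔼 s : ι → Bool, (𝔼 i, (∑ a, ind (δ a) * (h i a * (x a * sgn (s a)))) ^ 2 *
      (∑ a, ind (!δ a) * (h i a * (x a * sgn (s a)))) ^ 2) ^ p ≤
      (2 * Real.exp 2) ^ p * (1 + (4 * p * R) ^ p * √S) := by
  rw [expect_mix δ]
  set f : (ι → Bool) → ℝ := fun s => fourth h (fun a => ind (!δ a) * x a * sgn (s a)) with hf
  have hf0 : ∀ s, 0 ≤ f s := fun s => fourth_nonneg _ _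
  have inner : ∀ s' : ι → Bool, 𝔼 s : ι → Bool,
      (𝔼 i, (∑ a, ind (δ a) * (h i a * (x a * sgn (mix δ s s' a)))) ^ 2 *
      (∑ a, ind (!δ a) * (h i a * (x a * sgn (mix δ s s' a)))) ^ 2) ^ p ≤
      (Real.exp 2 * (1 + 4 * p * (√(f s') * R))) ^ p := by
    intro s'
    set y : κ → ℝ := fun i => ∑ a, h i a * (ind (!δ a) * x a * sgn (s' a)) with hy
    set c : ℝ := (Fintype.card κ : ℝ) with hc
    have hc0 : 0 < c := by rw [hc]; exact_mod_cast Fintype.card_pos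
    set N : Matrix κ ι ℝ := fun i a => (√c)⁻¹ * (y i * (h i a * (ind (δ a) * x a))) with hN
    have hNu : ∀ u : ι → ℝ, ∑ i, (∑ a, N i a * u a) ^ 2 =
        𝔼 i, y i ^ 2 * (∑ a, h i a * ((ind (δ a) * x a) * u a)) ^ 2 := by
      intro u
      rw [Fintype.expect_eq_sum_div_card, Finset.sum_div]
      refine Finset.sum_congr rfl fun i _ => ?_
      have : ∑ a, N i a * u a = (√c)⁻¹ * (y i * ∑ a, h i a * ((ind (δ a) * x a) * u a)) := by
        simp only [hN, Finset.mul_sum]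
        exact Finset.sum_congr rfl fun a _ => by ring
      rw [this, mul_pow, inv_pow, Real.sq_sqrt hc0.le, mul_pow]
      ring
    have hop : ∀ u : ι → ℝ, ∑ i, (∑ a, N i a * u a) ^ 2 ≤ (√(f s') * R) * ∑ a, u a ^ 2 := by
      intro u
      rw [hNu]
      refine (expect_mul_le_sqrt_mul_sqrt _ _).trans ?_
      simp only [← pow_mul, Nat.reduceMul]
      rw [mul_assoc]
      refine mul_le_mul_of_nonneg_left ?_ (Real.sqrt_nonneg _)
      apply Real.sqrt_le_iff.2 ⟨by positivity, ?_⟩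
      refine (hh.fourth_le _ _).trans ?_
      rw [mul_pow]
      refine mul_le_mul_of_nonneg_right ?_ (by positivity)
      exact (sum_ind_mul_pow_le δ x (by decide)).trans hxR
    have hfr : ∑ i, ∑ a, N i a ^ 2 ≤ 1 := by
      have e : ∑ i, ∑ a, N i a ^ 2 = (𝔼 i, y i ^ 2) * ∑ a, (ind (δ a) * x a) ^ 2 := by
        rw [Fintype.expect_eq_sum_div_card, Finset.sum_div, Finset.sum_mul_sum]
        refine Finset.sum_congr rfl fun i _ => Finset.sum_congr rfl fun a _ => ?_
        simp only [hN]
        rw [mul_pow, mul_pow, mul_pow (h i a), hh.sq_eq_one, inv_pow, Real.sq_sqrt hc0.le]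
        ring
      rw [e, hh.parseval]
      refine mul_le_one₀ ?_ (by positivity) ((sum_ind_mul_pow_le δ x even_two).trans hx)
      simp only [mul_pow _ (sgn _), sgn_sq, mul_one]
      exact (sum_ind_mul_pow_le (fun a => !δ a) x even_two).trans hx
    refine le_trans (le_of_eq ?_) (expect_sq_norm_pow_le N (by positivity) hop hfr hp)
    refine Finset.expect_congr rfl fun s _ => ?_
    rw [hNu]
    congr 1
    refine Finset.expect_congr rfl fun i _ => ?_
    rw [mul_comm]
    congr 2
    · refine Finset.sum_congr rfl fun a _ => ?_
      by_cases ha : δ a = true <;> simp [mix, ha, ind]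
    · refine Finset.sum_congr rfl fun a _ => ?_
      by_cases ha : δ a = true <;> simp [mix, ha, ind]
  calc _ ≤ 𝔼 s' : ι → Bool, (2 * Real.exp 2) ^ p * (1 + (4 * p * R) ^ p * √(f s' ^ p)) := by
        refine Finset.expect_le_expect fun s' _ => (inner s').trans ?_
        have h1 : √(f s' ^ p) = √(f s') ^ p := by
          rw [Real.sqrt_eq_iff_eq_sq (by have := hf0 s'; positivity) (by positivity), ← pow_mul,
            mul_comm, pow_mul, Real.sq_sqrt (hf0 s')]
        rw [h1, mul_pow, mul_pow 2, mul_comm (2 ^ p), mul_assoc (Real.exp 2 ^ p)]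
        refine mul_le_mul_of_nonneg_left ?_ (by positivity)
        refine (add_pow_le_two_pow_mul zero_le_one (by positivity) p).trans (le_of_eq ?_)
        rw [one_pow, ← mul_pow]
        ring
    _ = (2 * Real.exp 2) ^ p * (1 + (4 * p * R) ^ p * 𝔼 s', √(f s' ^ p)) := by
        rw [← Finset.mul_expect, Finset.expect_add_distrib, Fintype.expect_const,
          ← Finset.mul_expect]
    _ ≤ _ := by
        refine mul_le_mul_of_nonneg_left ?_ (by positivity)
        have : 𝔼 s', √(f s' ^ p) ≤ √S :=
          (expect_sqrt_le _ fun s => pow_nonneg (hf0 s) _).trans (Real.sqrt_le_sqrt hS)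
        gcongr

/-- The constant of the moment recursion. -/
noncomputable def recConst : ℝ := 4 + 64 * (2 * Real.exp 2)

lemma expect_fourth_pow_recursion (hh : IsFlatKernel h) {x : ι → ℝ} (hx : ∑ a, x a ^ 2 ≤ 1)
    {R : ℝ} (hR : 0 ≤ R) (hxR : ∑ a, x a ^ 4 ≤ R ^ 2) {p : ℕ} (hp : 1 ≤ p) {S : ℝ}
    (hS : ∀ δ : ι → Bool,
      𝔼 s : ι → Bool, fourth h (fun a => ind (δ a) * x a * sgn (s a)) ^ p ≤ S) :
    𝔼 s : ι → Bool, fourth h (fun a => x a * sgn (s a)) ^ p ≤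
      recConst ^ p * (1 + (4 * p * R) ^ p * √S) := by
  set D : (ι → Bool) → (ι → Bool) → ℝ := fun δ s =>
    𝔼 i, (∑ a, ind (δ a) * (h i a * (x a * sgn (s a)))) ^ 2 *
      (∑ a, ind (!δ a) * (h i a * (x a * sgn (s a)))) ^ 2 with hD
  have hD0 : ∀ δ s, 0 ≤ D δ s := fun δ s => Finset.expect_nonneg fun i _ => by positivity
  have h1 : ∀ s : ι → Bool, fourth h (fun a => x a * sgn (s a)) ^ p ≤
      𝔼 δ, (4 ^ p + 64 ^ p * D δ s ^ p) := by
    intro s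
    calc _ ≤ (𝔼 δ, (2 + 32 * D δ s)) ^ p := by
          refine pow_le_pow_left₀ (fourth_nonneg _ _) (fourth_le_decoupled hh ?_) p
          simpa only [mul_pow, sgn_sq, mul_one] using hx
      _ ≤ 𝔼 δ, (2 + 32 * D δ s) ^ p :=
          expect_pow_le p _ fun δ => by have := hD0 δ s; positivity
      _ ≤ _ := by
          refine Finset.expect_le_expect fun δ _ => ?_
          have := hD0 δ s
          refine (add_pow_le_two_pow_mul zero_le_two (by positivity) p).trans (le_of_eq ?_)
          rw [mul_pow, mul_add, ← mul_assoc, ← mul_pow, ← mul_pow]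
          norm_num
  set B := 1 + (4 * p * R) ^ p * √S with hB
  have hB1 : 1 ≤ B := by
    have : 0 ≤ (4 * p * R) ^ p * √S := by positivity
    linarith
  calc _ ≤ 𝔼 s, 𝔼 δ, (4 ^ p + 64 ^ p * D δ s ^ p) := Finset.expect_le_expect fun s _ => h1 s
    _ = 𝔼 δ, (4 ^ p + 64 ^ p * 𝔼 s, D δ s ^ p) := by
        rw [Finset.expect_comm]
        refine Finset.expect_congr rfl fun δ _ => ?_
        rw [Finset.expect_add_distrib, Fintype.expect_const, Finset.mul_expect]
    _ ≤ 4 ^ p * B + 64 ^ p * ((2 * Real.exp 2) ^ p * B) := by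
        refine Finset.expect_le Finset.univ_nonempty fun δ _ => ?_
        refine add_le_add (le_mul_of_one_le_right (by positivity) hB1) ?_
        refine mul_le_mul_of_nonneg_left ?_ (by positivity)
        exact expect_decoupled_pow_le hh hx hR hxR hp δ (hS fun a => !δ a)
    _ = (4 ^ p + (64 * (2 * Real.exp 2)) ^ p) * B := by rw [mul_pow 64]; ring
    _ ≤ _ := by
        refine mul_le_mul_of_nonneg_right ?_ (by linarith)
        exact pow_add_pow_le (by positivity) (by positivity) (by omega)

/-- A self-bounding argument: a restriction of a restriction of `x` is again one, so the largest
moment `M` over all restrictions satisfies `M ≤ K ^ p + B √M`. By the inequality of means `M ≤ 2 K ^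
p + B²`, and the bound `1 / p` on the fourth powers gives `B² = (16 K² p) ^ p`. -/
lemma expect_fourth_pow_le_of_sum_fourth_le (hh : IsFlatKernel h) {x : ι → ℝ}
    (hx : ∑ a, x a ^ 2 ≤ 1) {p : ℕ} (hp : 1 ≤ p) (hxp : ∑ a, x a ^ 4 ≤ 1 / p) :
    𝔼 s : ι → Bool, fourth h (fun a => x a * sgn (s a)) ^ p ≤
      ((2 * recConst + 16 * recConst ^ 2) * p) ^ p := by
  have hp0 : (0 : ℝ) < p := by exact_mod_cast hp
  have hp1 : (1 : ℝ) ≤ p := by exact_mod_cast hp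
  have hK : 0 < recConst := by unfold recConst; positivity
  set Φ : (ι → Bool) → ℝ := fun J =>
    𝔼 s : ι → Bool, fourth h (fun a => ind (J a) * x a * sgn (s a)) ^ p with hΦ
  obtain ⟨J, hJ⟩ := Finite.exists_max Φ
  have hM0 : 0 ≤ Φ J := Finset.expect_nonneg fun s _ => pow_nonneg (fourth_nonneg _ _) _
  set R := √(1 / p : ℝ) with hR
  have hR2 : R ^ 2 = 1 / p := Real.sq_sqrt (by positivity)
  have hrec := expect_fourth_pow_recursion hh (x := fun a => ind (J a) * x a) (S := Φ J)
    ((sum_ind_mul_pow_le J x even_two).trans hx) (Real.sqrt_nonneg _)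
    (((sum_ind_mul_pow_le J x (by decide)).trans hxp).trans hR2.ge) hp (by
      intro δ
      refine le_trans (le_of_eq ?_) (hJ fun a => δ a && J a)
      refine Finset.expect_congr rfl fun s _ => ?_
      congr 2
      ext a
      rw [← mul_assoc]
      by_cases h1 : δ a = true <;> by_cases h2 : J a = true <;> simp [ind, h1, h2])
  change Φ J ≤ _ at hrec
  have hbound : Φ J ≤ 2 * recConst ^ p + (16 * recConst ^ 2 * p) ^ p := by
    set B := (4 * recConst * p * R) ^ p with hB
    have e1 : recConst ^ p * (1 + (4 * p * R) ^ p * √(Φ J)) = recConst ^ p + B * √(Φ J) := by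
      rw [hB, show 4 * recConst * p * R = recConst * (4 * p * R) by ring, mul_pow recConst]; ring
    have e2 : B ^ 2 = (16 * recConst ^ 2 * p) ^ p := by
      rw [hB, ← pow_mul, mul_comm p 2, pow_mul]
      congr 1
      rw [mul_pow, hR2]
      field_simp
      ring
    rw [e1] at hrec
    have h3 := Real.sq_sqrt hM0
    nlinarith [sq_nonneg (B - √(Φ J))]
  have hx1 : 𝔼 s : ι → Bool, fourth h (fun a => x a * sgn (s a)) ^ p ≤ Φ J := by
    refine le_trans (le_of_eq ?_) (hJ fun _ => true)
    simp [hΦ, ind]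
  refine (hx1.trans hbound).trans ?_
  calc 2 * recConst ^ p + (16 * recConst ^ 2 * p) ^ p
      ≤ (2 * recConst * p) ^ p + (16 * recConst ^ 2 * p) ^ p := by
        refine add_le_add ?_ le_rfl
        rw [mul_pow, mul_pow]
        have h2 : (2 : ℝ) ≤ 2 ^ p := le_self_pow₀ one_le_two (by omega)
        have h3 : (1 : ℝ) ≤ (p : ℝ) ^ p := one_le_pow₀ hp1
        have h4 : 2 * recConst ^ p ≤ 2 ^ p * recConst ^ p :=
          mul_le_mul_of_nonneg_right h2 (by positivity)
        exact h4.trans (le_mul_of_one_le_right (by positivity) h3)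
    _ ≤ _ := by
        rw [add_mul]
        exact pow_add_pow_le (by positivity) (by positivity) (by omega)

/-- The constant in the moment bound. -/
noncomputable def momConst : ℝ := 16 * (1 + (2 * recConst + 16 * recConst ^ 2))

lemma momConst_pos : 0 < momConst := by unfold momConst recConst; positivity

/-- The moments of the mean fourth power of the coordinates of a randomly signed unit vector. -/
theorem expect_fourth_pow_le (hh : IsFlatKernel h) {x : ι → ℝ} (hx : ∑ a, x a ^ 2 ≤ 1) {p : ℕ}
    (hp : 1 ≤ p) :
    𝔼 s : ι → Bool, fourth h (fun a => x a * sgn (s a)) ^ p ≤ (momConst * p) ^ p := by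
  classical
  have hp0 : (0 : ℝ) < p := by exact_mod_cast hp
  have hK : 0 < recConst := by unfold recConst; positivity
  -- Split at `|x a| = p ^ (-1/2)`. The large part has `ℓ¹` norm at most `√p`, so all its transforms
  -- are bounded by `√p` whatever the signs; the small part has `∑ v⁴ ≤ 1 / p`, as the self-bounding
  -- argument needs.
  set b : ι → ℝ := fun a => if 1 < p * x a ^ 2 then x a else 0 with hb
  set v : ι → ℝ := fun a => if 1 < p * x a ^ 2 then 0 else x a with hv
  have hbig : ∀ s : ι → Bool, fourth h (fun a => b a * sgn (s a)) ≤ p := by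
    intro s
    have hb2 : ∑ a, b a ^ 2 ≤ 1 := by
      refine le_trans (Finset.sum_le_sum fun a _ => ?_) hx
      simp only [hb]; split_ifs <;> simp [sq_nonneg]
    have habs : ∀ a, |b a| ≤ √p * b a ^ 2 := by
      intro a
      simp only [hb]
      split_ifs with hc
      · rw [← sq_abs (x a)] at hc ⊢
        have h1 : 1 ≤ √p * |x a| := by
          rw [← Real.sqrt_sq (abs_nonneg (x a)), ← Real.sqrt_mul hp0.le]
          exact Real.one_le_sqrt.2 hc.le
        nlinarith [abs_nonneg (x a)]
      · simp
    have hy : ∀ i, (∑ a, h i a * (b a * sgn (s a))) ^ 2 ≤ p := by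
      intro i
      have h1 : |∑ a, h i a * (b a * sgn (s a))| ≤ √p := by
        refine (Finset.abs_sum_le_sum_abs _ _).trans ?_
        calc ∑ a, |h i a * (b a * sgn (s a))| = ∑ a, |b a| := by
              refine Finset.sum_congr rfl fun a _ => ?_
              have e1 : |h i a| = 1 := by
                rcases eq_or_eq_neg_of_sq_eq_sq _ _ ((hh.sq_eq_one i a).trans (one_pow 2).symm) with e | e <;>
                  simp [e]
              have e2 : |sgn (s a)| = 1 := by cases s a <;> simp [sgn]
              rw [abs_mul, abs_mul, e1, e2, one_mul, mul_one]
          _ ≤ ∑ a, √p * b a ^ 2 := Finset.sum_le_sum fun a _ => habs a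
          _ ≤ √p := by
              rw [← Finset.mul_sum]
              exact mul_le_of_le_one_right (Real.sqrt_nonneg _) hb2
      rw [← sq_abs, ← Real.sq_sqrt hp0.le]
      exact pow_le_pow_left₀ (abs_nonneg _) h1 2
    calc fourth h (fun a => b a * sgn (s a))
        ≤ 𝔼 i, p * (∑ a, h i a * (b a * sgn (s a))) ^ 2 := by
          refine Finset.expect_le_expect fun i _ => ?_
          have := hy i
          nlinarith [sq_nonneg (∑ a, h i a * (b a * sgn (s a)))]
      _ ≤ p := by
          rw [← Finset.mul_expect, hh.parseval]
          simp only [mul_pow, sgn_sq, mul_one]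
          exact mul_le_of_le_one_right hp0.le hb2
  have hsmall := expect_fourth_pow_le_of_sum_fourth_le hh (x := v) (p := p) (by
      refine le_trans (Finset.sum_le_sum fun a _ => ?_) hx
      simp only [hv]; split_ifs <;> simp [sq_nonneg]) hp (by
      rw [le_div_iff₀ hp0]
      refine le_trans ?_ hx
      rw [Finset.sum_mul]
      refine Finset.sum_le_sum fun a _ => ?_
      simp only [hv]
      split_ifs with hc
      · simp [sq_nonneg]
      · nlinarith [sq_nonneg (x a)])
  calc 𝔼 s : ι → Bool, fourth h (fun a => x a * sgn (s a)) ^ p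
      ≤ 𝔼 s : ι → Bool, 16 ^ p * ((p : ℝ) ^ p + fourth h (fun a => v a * sgn (s a)) ^ p) := by
        refine Finset.expect_le_expect fun s _ => ?_
        have e : (fun a => x a * sgn (s a)) =
            (fun a => b a * sgn (s a)) + fun a => v a * sgn (s a) := by
          ext a
          simp only [hb, hv, Pi.add_apply]
          split_ifs <;> simp
        have f0 := fourth_nonneg h fun a => v a * sgn (s a)
        have h1 : fourth h (fun a => x a * sgn (s a)) ≤
            8 * (p + fourth h fun a => v a * sgn (s a)) := by
          rw [e]
          refine (fourth_add_le _ _ _).trans ?_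
          have := hbig s
          gcongr
        refine (pow_le_pow_left₀ (fourth_nonneg _ _) h1 p).trans ?_
        rw [mul_pow, show (16 : ℝ) = 8 * 2 by norm_num, mul_pow, mul_assoc]
        exact mul_le_mul_of_nonneg_left (add_pow_le_two_pow_mul hp0.le f0 p) (by positivity)
    _ ≤ 16 ^ p * ((p : ℝ) ^ p + ((2 * recConst + 16 * recConst ^ 2) * p) ^ p) := by
        rw [← Finset.mul_expect, Finset.expect_add_distrib, Fintype.expect_const]
        gcongr
    _ ≤ _ := by
        rw [momConst, mul_assoc, mul_pow 16, add_mul 1, one_mul]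
        refine mul_le_mul_of_nonneg_left ?_ (by positivity)
        exact pow_add_pow_le hp0.le (by positivity) (by omega)

open Classical in
/-- The tail of the mean fourth power of the coordinates of a randomly signed unit vector. -/
theorem expect_fourth_tail_le (hh : IsFlatKernel h) {x : ι → ℝ} (hx : ∑ a, x a ^ 2 ≤ 1) {p : ℕ}
    (hp : 1 ≤ p) :
    𝔼 s : ι → Bool, (if momConst * Real.exp 1 * p < fourth h (fun a => x a * sgn (s a))
      then (1 : ℝ) else 0) ≤ Real.exp (-p) := by
  have hp0 : (0 : ℝ) < p := by exact_mod_cast hp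
  have hK := momConst_pos
  set c := momConst * Real.exp 1 * p with hc
  have hc0 : 0 < c := by positivity
  calc _ ≤ 𝔼 s : ι → Bool, (c ^ p)⁻¹ * fourth h (fun a => x a * sgn (s a)) ^ p := by
        refine Finset.expect_le_expect fun s _ => ?_
        have f0 := fourth_nonneg h fun a => x a * sgn (s a)
        split_ifs with hs
        · rw [← div_eq_inv_mul, one_le_div (by positivity)]
          exact pow_le_pow_left₀ hc0.le hs.le p
        · positivity
    _ ≤ (c ^ p)⁻¹ * (momConst * p) ^ p := by
        rw [← Finset.mul_expect]
        exact mul_le_mul_of_nonneg_left (expect_fourth_pow_le hh hx hp) (by positivity)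
    _ = _ := by
        rw [← inv_pow, ← mul_pow, Real.exp_neg, ← Real.exp_one_pow, ← inv_pow]
        congr 1
        rw [hc]
        field_simp

end Moments

/-! ### Characters of the Boolean cube and the Walsh–Hadamard matrix. -/

section Walsh

/-- The nontrivial additive character of `ZMod 2`. -/
noncomputable def psi (z : ZMod 2) : ℝ := if z = 0 then 1 else -1

@[simp] lemma psi_zero : psi 0 = 1 := by simp [psi]

@[simp] lemma psi_one : psi 1 = -1 := by simp [psi]

lemma zmod_two_cases (x : ZMod 2) : x = 0 ∨ x = 1 := by revert x; decide

lemma psi_add (x y : ZMod 2) : psi (x + y) = psi x * psi y := by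
  have h : (1 + 1 : ZMod 2) = 0 := by decide
  rcases zmod_two_cases x with rfl | rfl <;> rcases zmod_two_cases y with rfl | rfl <;> simp [h]

lemma psi_sq (x : ZMod 2) : psi x ^ 2 = 1 := by
  rcases zmod_two_cases x with rfl | rfl <;> simp

lemma sum_zmod_two {M : Type*} [AddCommMonoid M] (f : ZMod 2 → M) : ∑ z, f z = f 0 + f 1 :=
  Fin.sum_univ_two f

/-- The characters of the Boolean cube, as a symmetric `±1` kernel. -/
noncomputable def chi {ι : Type*} [Fintype ι] (u v : ι → ZMod 2) : ℝ := ∏ b, psi (u b * v b)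

variable {ι : Type*} [Fintype ι]

lemma chi_comm (u v : ι → ZMod 2) : chi u v = chi v u := by
  simp [chi, mul_comm]

@[simp] lemma chi_zero_left (v : ι → ZMod 2) : chi 0 v = 1 := by simp [chi]

@[simp] lemma chi_zero_right (v : ι → ZMod 2) : chi v 0 = 1 := by simp [chi]

lemma chi_add_right (u v w : ι → ZMod 2) : chi u (v + w) = chi u v * chi u w := by
  simp [chi, mul_add, psi_add, Finset.prod_mul_distrib]

lemma chi_add_left (u v w : ι → ZMod 2) : chi (u + v) w = chi u w * chi v w := by
  simp [chi, add_mul, psi_add, Finset.prod_mul_distrib]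

lemma chi_sq (u v : ι → ZMod 2) : chi u v ^ 2 = 1 := by
  simp [chi, ← Finset.prod_pow, psi_sq]

lemma chi_eq_or (u v : ι → ZMod 2) : chi u v = 1 ∨ chi u v = -1 :=
  eq_or_eq_neg_of_sq_eq_sq _ _ ((chi_sq u v).trans (one_pow 2).symm)

lemma chi_sum_left {κ : Type*} (T : Finset κ) (u : κ → ι → ZMod 2) (v : ι → ZMod 2) :
    chi (∑ a ∈ T, u a) v = ∏ a ∈ T, chi (u a) v := by
  classical
  induction T using Finset.induction_on with
  | empty => simp
  | insert a T ha ih => rw [Finset.sum_insert ha, Finset.prod_insert ha, chi_add_left, ih]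

variable [DecidableEq ι]

lemma sum_chi (u : ι → ZMod 2) :
    ∑ v, chi u v = if u = 0 then (2 : ℝ) ^ Fintype.card ι else 0 := by
  have h1 : ∑ v, chi u v = ∏ b, ∑ z, psi (u b * z) := by
    rw [Finset.prod_univ_sum, Fintype.piFinset_univ]
    rfl
  rw [h1]
  simp only [sum_zmod_two, mul_zero, mul_one, psi_zero]
  split_ifs with hu
  · subst hu; norm_num
  · obtain ⟨b, hb⟩ := Function.ne_iff.1 hu
    apply Finset.prod_eq_zero (Finset.mem_univ b)
    rcases zmod_two_cases (u b) with h | h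
    · exact absurd h hb
    · rw [h]; simp

lemma expect_chi (u : ι → ZMod 2) : 𝔼 v, chi v u = if u = 0 then 1 else 0 := by
  rw [Fintype.expect_eq_sum_div_card]
  simp only [chi_comm _ u, sum_chi]
  split_ifs <;> simp

/-- Reindexing of a double sum over the cube by differences. -/
lemma sum_sum_cube {M : Type*} [AddCommMonoid M] (F : (ι → ZMod 2) → (ι → ZMod 2) → M) :
    ∑ a, ∑ b, F a b = ∑ c, ∑ a, F a (a + c) := by
  rw [Finset.sum_comm' (s := Finset.univ) (t := fun _ => Finset.univ) (t' := Finset.univ)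
    (s' := fun _ => Finset.univ) (by simp) (f := fun c a => F a (a + c))]
  refine Finset.sum_congr rfl fun a _ => ?_
  exact (Equiv.sum_comp (Equiv.addLeft a) (F a)).symm

lemma chi_parseval (w : (ι → ZMod 2) → ℝ) :
    𝔼 i, (∑ a, chi i a * w a) ^ 2 = ∑ a, w a ^ 2 := by
  have h1 : ∀ i : ι → ZMod 2, (∑ a, chi i a * w a) ^ 2 =
      ∑ c, ∑ a, (w a * w (a + c)) * chi i c := by
    intro i
    rw [sq, Finset.sum_mul_sum, sum_sum_cube]
    refine Finset.sum_congr rfl fun c _ => Finset.sum_congr rfl fun a _ => ?_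
    rw [chi_add_right]
    linear_combination (w a * w (a + c) * chi i c) * chi_sq i a
  simp only [h1, Finset.expect_sum_comm, ← Finset.mul_expect, expect_chi]
  rw [Finset.sum_eq_single 0 (fun c _ hc => by simp [hc]) (by simp)]
  simp [sq]

/-- The square of a character sum is the character sum of the autocorrelation `W`. Parseval turns
the fourth moment into `∑ W c ^ 2`, and Cauchy–Schwarz in each `W c` separates `x` from `u`. -/
lemma chi_fourth_le (x u : (ι → ZMod 2) → ℝ) :
    𝔼 i, (∑ a, chi i a * (x a * u a)) ^ 4 ≤ (∑ a, x a ^ 4) * (∑ a, u a ^ 2) ^ 2 := by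
  set W : (ι → ZMod 2) → ℝ := fun c => ∑ a, (x a * x (a + c)) * (u a * u (a + c)) with hW
  have h1 : ∀ i : ι → ZMod 2, (∑ a, chi i a * (x a * u a)) ^ 4 = (∑ c, chi i c * W c) ^ 2 := by
    intro i
    rw [show 4 = 2 * 2 by rfl, pow_mul]
    congr 1
    rw [sq, Finset.sum_mul_sum, sum_sum_cube]
    refine Finset.sum_congr rfl fun c _ => ?_
    rw [hW, Finset.mul_sum]
    refine Finset.sum_congr rfl fun a _ => ?_
    rw [chi_add_right]
    linear_combination (x a * x (a + c) * (u a * u (a + c)) * chi i c) * chi_sq i a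
  simp only [h1, chi_parseval]
  have hx : ∀ c, ∑ a, (x a * x (a + c)) ^ 2 ≤ ∑ a, x a ^ 4 := by
    intro c
    have e : ∑ a, x (a + c) ^ 4 = ∑ a, x a ^ 4 := Equiv.sum_comp (Equiv.addRight c) fun a => x a ^ 4
    have : ∑ a, (x a * x (a + c)) ^ 2 ≤ ∑ a, (x a ^ 4 + x (a + c) ^ 4) / 2 :=
      Finset.sum_le_sum fun a _ => by nlinarith [sq_nonneg (x a ^ 2 - x (a + c) ^ 2)]
    rw [← Finset.sum_div, Finset.sum_add_distrib, e] at this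
    linarith
  have hu : ∑ c, ∑ a, (u a * u (a + c)) ^ 2 = (∑ a, u a ^ 2) ^ 2 := by
    rw [sq (∑ a, u a ^ 2), Finset.sum_mul_sum,
      sum_sum_cube fun a b => u a ^ 2 * u b ^ 2]
    simp only [mul_pow]
  rw [← hu, Finset.mul_sum]
  refine Finset.sum_le_sum fun c _ => ?_
  refine (Finset.sum_mul_sq_le_sq_mul_sq _ _ _).trans ?_
  exact mul_le_mul_of_nonneg_right (hx c) (by positivity)

/-- The binary digits of a number below `2 ^ n`. -/
noncomputable def bits (n : ℕ) : Fin (2 ^ n) ≃ (Fin n → ZMod 2) :=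
  Equiv.ofBijective (fun i b => if (i : ℕ).testBit b then 1 else 0) <| by
    rw [Fintype.bijective_iff_injective_and_card]
    refine ⟨fun i j hij => ?_, by simp⟩
    ext
    apply Nat.eq_of_testBit_eq
    intro b
    by_cases hb : b < n
    · have := congrFun hij ⟨b, hb⟩
      dsimp only at this
      by_cases h1 : (i : ℕ).testBit b = true <;> by_cases h2 : (j : ℕ).testBit b = true <;>
        simp_all
    · rw [Nat.testBit_lt_two_pow (i.2.trans_le (Nat.pow_le_pow_right two_pos (not_lt.1 hb))),
        Nat.testBit_lt_two_pow (j.2.trans_le (Nat.pow_le_pow_right two_pos (not_lt.1 hb)))]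

lemma bits_apply (n : ℕ) (i : Fin (2 ^ n)) (b : Fin n) :
    bits n i b = if (i : ℕ).testBit b then 1 else 0 := rfl

lemma walshHadamard_eq (n : ℕ) (i j : Fin (2 ^ n)) :
    walshHadamard n i j = (√(2 ^ n : ℝ))⁻¹ * chi (bits n i) (bits n j) := by
  simp only [walshHadamard, Matrix.of_apply, bitDot, chi, bits_apply]
  congr 1
  rw [Finset.card_filter, ← Finset.prod_pow_eq_pow_sum, Finset.prod_range]
  refine Finset.prod_congr rfl fun b _ => ?_
  by_cases h1 : (i : ℕ).testBit b = true <;> by_cases h2 : (j : ℕ).testBit b = true <;>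
    simp [h1, h2]

/-- The signs of the Walsh–Hadamard matrix. -/
noncomputable def walshSign (n : ℕ) (i j : Fin (2 ^ n)) : ℝ := chi (bits n i) (bits n j)

lemma isFlatKernel_walshSign (n : ℕ) : IsFlatKernel (walshSign n) where
  sq_eq_one i a := chi_sq _ _
  parseval w := by
    have := chi_parseval fun a => w ((bits n).symm a)
    rw [← (bits n).sum_comp] at this
    simp only [Equiv.symm_apply_apply] at this
    rw [← this]
    refine Fintype.expect_equiv (bits n) _ _ fun i => ?_
    rw [← (bits n).sum_comp]
    simp [walshSign]
  fourth_le x u := by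
    have := chi_fourth_le (fun a => x ((bits n).symm a)) (fun a => u ((bits n).symm a))
    rw [← (bits n).sum_comp, ← (bits n).sum_comp (fun a => u ((bits n).symm a) ^ 2)] at this
    simp only [Equiv.symm_apply_apply] at this
    refine le_trans (le_of_eq ?_) this
    refine Fintype.expect_equiv (bits n) _ _ fun i => ?_
    rw [← (bits n).sum_comp]
    simp [walshSign]

end Walsh

/-! ### Fourth moments under 4-wise independence. -/

section FourWise

variable {k d : ℕ} {B : Matrix (Fin k) (Fin d) ℝ}

/-- In a 4-wise independent sign matrix, the product of at most four distinct rows sums to zero. -/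
lemma sum_prod_rows_eq_zero {β : Fin k → Fin d → ℝ} (hβ : ∀ i j, β i j = 1 ∨ β i j = -1)
    (hB : ∀ i : Fin 4 → Fin k, StrictMono i → ∀ b : Fin 4 → Bool,
      16 * ((univ.filter fun j => ∀ a, β (i a) j = sgn (b a)).card : ℝ) = d)
    (hk : 4 ≤ k) {S : Finset (Fin k)} (hS : S.Nonempty) (hS4 : S.card ≤ 4) :
    ∑ j, ∏ i ∈ S, β i j = 0 := by
  -- The hypothesis speaks of exactly four rows, so smaller sets are padded; this is where `4 ≤ k`
  -- is needed. All 16 patterns on `T` are equally frequent, so the sum over columns is a multiple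
  -- of the mean of `G`, in which some sign averages to zero.
  obtain ⟨T, hST, hT⟩ := Finset.exists_superset_card_eq hS4 (by simpa using hk)
  set f := T.orderEmbOfFin hT with hf
  have hinj : Function.Injective f := f.injective
  have himg : T = univ.image f := by
    ext i
    rw [← Finset.mem_coe, ← Finset.range_orderEmbOfFin T hT]
    simp [hf]
  set G : (Fin 4 → Bool) → ℝ := fun b => ∏ a, if f a ∈ S then sgn (b a) else 1 with hG
  have h1 : ∀ (b : Fin 4 → Bool) (j : Fin d), (∀ a, β (f a) j = sgn (b a)) →
      ∏ i ∈ S, β i j = G b := by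
    intro b j hj
    have : ∏ i ∈ S, β i j = ∏ i ∈ T, if i ∈ S then β i j else 1 := by
      rw [Finset.prod_ite_mem, Finset.inter_eq_right.2 hST]
    rw [this, himg, Finset.prod_image hinj.injOn]
    exact Finset.prod_congr rfl fun a _ => by rw [hj]
  set bt : Fin d → Fin 4 → Bool := fun j a => decide (β (f a) j = -1) with hbt
  have hfib : ∀ b j, bt j = b ↔ ∀ a, β (f a) j = sgn (b a) := by
    intro b j
    rw [funext_iff]
    refine forall_congr' fun a => ?_
    rcases hβ (f a) j with h | h <;> cases hb : b a <;> simp [hbt, h, sgn] <;> norm_num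
  rw [← Finset.sum_fiberwise univ bt]
  have h2 : ∀ b, ∑ j with bt j = b, ∏ i ∈ S, β i j = d / 16 * G b := by
    intro b
    rw [Finset.sum_congr rfl fun j hj => h1 b j ((hfib b j).1 (Finset.mem_filter.1 hj).2),
      Finset.sum_const, nsmul_eq_mul]
    have := hB f f.strictMono b
    simp only [hfib]
    rw [← this]
    ring
  simp only [h2, ← Finset.mul_sum]
  have h3 : 𝔼 b, G b = 0 := by
    rw [hG, expect_prod_apply fun a c => if f a ∈ S then sgn c else 1]
    obtain ⟨i, hi⟩ := hS
    have hiT := hST hi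
    rw [himg] at hiT
    obtain ⟨a, -, rfl⟩ := Finset.mem_image.1 hiT
    apply Finset.prod_eq_zero (Finset.mem_univ a)
    rw [Fintype.expect_eq_sum_div_card]
    simp [hi, sgn]
  rw [← Fintype.card_mul_expect, h3]
  simp

/-- The product survives only if the indices pair up. The three pairings are counted separately;
when all four indices agree they all apply, hence the correction by 2. -/
lemma sum_four_rows {β : Fin k → Fin d → ℝ} (hβ : ∀ i j, β i j = 1 ∨ β i j = -1)
    (h0 : ∀ S : Finset (Fin k), S.Nonempty → S.card ≤ 4 → ∑ j, ∏ i ∈ S, β i j = 0)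
    (p q r s : Fin k) :
    ∑ j, β p j * β q j * (β r j * β s j) =
      d * ((if p = q then if r = s then 1 else 0 else 0) +
        (if p = r then if q = s then 1 else 0 else 0) +
        (if p = s then if q = r then 1 else 0 else 0) -
        2 * (if p = q then if p = r then if p = s then 1 else 0 else 0 else 0)) := by
  have hsq : ∀ i j, β i j * β i j = 1 := fun i j => by rcases hβ i j with h | h <;> rw [h] <;> norm_num
  have h2 : ∀ a b, ∑ j, β a j * β b j = d * if a = b then 1 else 0 := by
    intro a b
    split_ifs with hab
    · subst hab; simp [hsq]
    · have := h0 {a, b} (by simp) (by rw [Finset.card_pair hab]; norm_num)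
      simpa [Finset.prod_pair hab] using this
  by_cases hpq : p = q
  · subst hpq
    simp only [hsq, one_mul, h2]
    by_cases h1 : p = r <;> by_cases h3 : p = s <;> by_cases h4 : r = s <;>
      simp_all
    norm_num
  by_cases hpr : p = r
  · subst hpr
    rw [Finset.sum_congr rfl fun j _ => show β p j * β q j * (β p j * β s j) = β q j * β s j by
      linear_combination (β q j * β s j) * hsq p j, h2]
    by_cases h3 : p = s <;> by_cases h4 : q = s <;> simp_all
  by_cases hps : p = s
  · subst hps
    rw [Finset.sum_congr rfl fun j _ => show β p j * β q j * (β r j * β p j) = β q j * β r j by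
      linear_combination (β q j * β r j) * hsq p j, h2]
    simp [hpq, hpr]
  by_cases hqr : q = r
  · subst hqr
    rw [Finset.sum_congr rfl fun j _ => show β p j * β q j * (β q j * β s j) = β p j * β s j by
      linear_combination (β p j * β s j) * hsq q j, h2]
    simp [hpq, hps]
  by_cases hqs : q = s
  · subst hqs
    rw [Finset.sum_congr rfl fun j _ => show β p j * β q j * (β r j * β q j) = β p j * β r j by
      linear_combination (β p j * β r j) * hsq q j, h2]
    simp [hpq, hpr]
  by_cases hrs : r = s
  · subst hrs
    simp only [hsq, mul_one, h2]
    simp [hpq, hpr]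
  have h4 := h0 {p, q, r, s} (by simp) ((Finset.card_insert_le _ _).trans (by
    have := Finset.card_le_three (a := q) (b := r) (c := s); omega))
  simp only [hpq, hpr, hps, if_false]
  rw [← h4.trans (by simp : (0 : ℝ) = d * (0 + 0 + 0 - 2 * 0))]
  refine Finset.sum_congr rfl fun j _ => ?_
  rw [Finset.prod_insert (by simp [hpq, hpr, hps]), Finset.prod_insert (by simp [hqr, hqs]),
    Finset.prod_pair hrs, mul_assoc]

/-- The fourth moment bound for sign matrices with 4-wise independent rows. -/
lemma sum_fourth_le {β : Fin k → Fin d → ℝ} (hβ : ∀ i j, β i j = 1 ∨ β i j = -1)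
    (h0 : ∀ S : Finset (Fin k), S.Nonempty → S.card ≤ 4 → ∑ j, ∏ i ∈ S, β i j = 0)
    (v : Fin k → ℝ) :
    ∑ j, (∑ i, β i j * v i) ^ 4 ≤ 3 * d * (∑ i, v i ^ 2) ^ 2 := by
  have h1 : ∀ j, (∑ i, β i j * v i) ^ 4 = ∑ p, ∑ q, ∑ r, ∑ s,
      (v p * v q * (v r * v s)) * (β p j * β q j * (β r j * β s j)) := by
    intro j
    rw [show 4 = 2 * 2 by rfl, pow_mul, sq (∑ i, _), Finset.sum_mul_sum, sq, Finset.sum_mul]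
    refine Finset.sum_congr rfl fun p _ => ?_
    rw [Finset.sum_mul]
    refine Finset.sum_congr rfl fun q _ => ?_
    rw [Finset.mul_sum]
    refine Finset.sum_congr rfl fun r _ => ?_
    rw [Finset.mul_sum]
    exact Finset.sum_congr rfl fun s _ => by ring
  have h2 : ∑ j, (∑ i, β i j * v i) ^ 4 = ∑ p, ∑ q, ∑ r, ∑ s,
      (v p * v q * (v r * v s)) * ∑ j, (β p j * β q j * (β r j * β s j)) := by
    simp only [h1, Finset.mul_sum]
    rw [Finset.sum_comm]
    refine Finset.sum_congr rfl fun p _ => ?_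
    rw [Finset.sum_comm]
    refine Finset.sum_congr rfl fun q _ => ?_
    rw [Finset.sum_comm]
    refine Finset.sum_congr rfl fun r _ => ?_
    rw [Finset.sum_comm]
  have h3 : ∑ j, (∑ i, β i j * v i) ^ 4 =
      d * (3 * (∑ i, v i ^ 2) ^ 2 - 2 * ∑ i, v i ^ 4) := by
    rw [h2]
    simp only [sum_four_rows hβ h0]
    have e : ∀ (w : ℝ) (a b c e : ℝ), w * (d * (a + b + c - 2 * e)) =
        d * (w * a + w * b + w * c - 2 * w * e) := by intros; ring
    simp only [e, ← Finset.mul_sum]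
    congr 1
    simp only [Finset.sum_add_distrib, Finset.sum_sub_distrib]
    simp only [mul_ite, mul_one, mul_zero, Finset.sum_ite_eq, Finset.mem_univ, if_true,
      Finset.sum_ite_irrel, Finset.sum_const_zero]
    have e1 : ∑ x, ∑ y, v x * v x * (v y * v y) = (∑ i, v i ^ 2) ^ 2 := by
      rw [sq (∑ i, _), Finset.sum_mul_sum]; simp only [sq]
    have e2 : ∑ x, ∑ y, v x * v y * (v x * v y) = (∑ i, v i ^ 2) ^ 2 := by
      rw [← e1]; exact Finset.sum_congr rfl fun x _ => Finset.sum_congr rfl fun y _ => by ring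
    have e3 : ∑ x, ∑ y, v x * v y * (v y * v x) = (∑ i, v i ^ 2) ^ 2 := by
      rw [← e1]; exact Finset.sum_congr rfl fun x _ => Finset.sum_congr rfl fun y _ => by ring
    have e4 : ∑ x, 2 * (v x * v x * (v x * v x)) = 2 * ∑ i, v i ^ 4 := by
      rw [Finset.mul_sum]; exact Finset.sum_congr rfl fun x _ => by ring
    rw [e1, e2, e3, e4]
    ring
  rw [h3]
  have : 0 ≤ d * ∑ i, v i ^ 4 := by positivity
  linarith

lemma IsFourWiseIndependent.sum_fourth_le (hB : IsFourWiseIndependent B) (hk : 4 ≤ k)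
    (v : Fin k → ℝ) :
    ∑ j, (∑ i, B i j * v i) ^ 4 ≤ 3 * d / k ^ 2 * (∑ i, v i ^ 2) ^ 2 := by
  have hk0 : (0 : ℝ) < k := by exact_mod_cast (by omega : 0 < k)
  have hsk : 0 < √(k : ℝ) := Real.sqrt_pos.2 hk0
  set β : Fin k → Fin d → ℝ := fun i j => √k * B i j with hβd
  have hβ : ∀ i j, β i j = 1 ∨ β i j = -1 := by
    intro i j
    rcases hB.1 i j with h | h
    · left; rw [hβd]; dsimp only; rw [h, mul_inv_cancel₀ hsk.ne']
    · right; rw [hβd]; dsimp only; rw [h, mul_neg, mul_inv_cancel₀ hsk.ne']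
  have hiff : ∀ i j c, β i j = c ↔ B i j = (√k)⁻¹ * c := by
    intro i j c
    rw [eq_inv_mul_iff_mul_eq₀ hsk.ne']
  have h0 : ∀ S : Finset (Fin k), S.Nonempty → S.card ≤ 4 → ∑ j, ∏ i ∈ S, β i j = 0 := by
    intro S hS hS4
    refine sum_prod_rows_eq_zero hβ ?_ hk hS hS4
    intro i hi b
    have := hB.2 i hi (fun a => sgn (b a)) fun a => by cases b a <;> simp [sgn]
    rw [Nat.card_eq_fintype_card, Fintype.card_subtype] at this
    simp only [hiff]
    exact_mod_cast this
  have := FastJL.sum_fourth_le hβ h0 v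
  have e : ∀ j, (∑ i, β i j * v i) ^ 4 = k ^ 2 * (∑ i, B i j * v i) ^ 4 := by
    intro j
    simp only [hβd, mul_assoc, ← Finset.mul_sum]
    rw [mul_pow, show 4 = 2 * 2 by rfl, pow_mul, Real.sq_sqrt hk0.le]
  simp only [e, ← Finset.mul_sum] at this
  rw [div_mul_eq_mul_div, le_div_iff₀ (by positivity)]
  linarith

end FourWise

/-! ### The tail bound for uniform signs. -/

section Tail

variable {k n : ℕ} {B : Matrix (Fin k) (Fin (2 ^ n)) ℝ}

lemma IsFourWiseIndependent.sq_eq {d : ℕ} {B : Matrix (Fin k) (Fin d) ℝ}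
    (hB : IsFourWiseIndependent B) (i : Fin k) (j : Fin d) : B i j ^ 2 = (k : ℝ)⁻¹ := by
  rcases hB.1 i j with h | h <;> rw [h] <;> simp [Real.sq_sqrt]

/-- The operator bound for the matrix of the Rademacher sum `B D y`, where `y` is the
Walsh–Hadamard transform of a unit vector `w`. -/
lemma IsFourWiseIndependent.operator_bound (hB : IsFourWiseIndependent B) (hk : 1 ≤ k)
    {w : Fin (2 ^ n) → ℝ} (hw : ∑ a, w a ^ 2 = 1) {y : Fin (2 ^ n) → ℝ}
    (hy : ∀ j, y j = (√(2 ^ n : ℝ))⁻¹ * ∑ a, walshSign n j a * w a) (v : Fin k → ℝ) :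
    ∑ j, (∑ i, B i j * y j * v i) ^ 2 ≤
      3 * √(fourth (walshSign n) w) / k * ∑ i, v i ^ 2 := by
  have hk0 : (0 : ℝ) < k := by exact_mod_cast hk
  have hd0 : (0 : ℝ) < 2 ^ n := by positivity
  have hflat := isFlatKernel_walshSign n
  have hy2 : ∑ j, y j ^ 2 = 1 := by
    have := hflat.parseval w
    rw [hw, Fintype.expect_eq_sum_div_card] at this
    simp only [hy, mul_pow, ← Finset.mul_sum, inv_pow, Real.sq_sqrt hd0.le]
    simpa [div_eq_inv_mul] using this
  have hy4 : ∑ j, y j ^ 4 = fourth (walshSign n) w / 2 ^ n := by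
    rw [fourth, Fintype.expect_eq_sum_div_card]
    simp only [hy, mul_pow, ← Finset.mul_sum, inv_pow]
    rw [show √(2 ^ n : ℝ) ^ 4 = 2 ^ n * 2 ^ n by
      rw [show 4 = 2 * 2 by rfl, pow_mul, Real.sq_sqrt hd0.le, sq]]
    simp only [Fintype.card_fin]
    push_cast
    field_simp
  have hN1 : 1 ≤ fourth (walshSign n) w := by
    have h1 := expect_sq_le fun i => (∑ a, walshSign n i a * w a) ^ 2
    rw [hflat.parseval, hw] at h1
    simpa [fourth, ← pow_mul] using h1
  have hsplit : ∀ j, (∑ i, B i j * y j * v i) ^ 2 = y j ^ 2 * (∑ i, B i j * v i) ^ 2 := by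
    intro j
    rw [← mul_pow, Finset.mul_sum]
    congr 1
    exact Finset.sum_congr rfl fun i _ => by ring
  have hv0 : 0 ≤ ∑ i, v i ^ 2 := by positivity
  simp only [hsplit]
  by_cases hk4 : 4 ≤ k
  · have h4 := hB.sum_fourth_le hk4 v
    have h5 : (∑ j, y j ^ 2 * (∑ i, B i j * v i) ^ 2) ^ 2 ≤
        (3 * √(fourth (walshSign n) w) / k * ∑ i, v i ^ 2) ^ 2 := by
      refine (Finset.sum_mul_sq_le_sq_mul_sq _ _ _).trans ?_
      simp only [← pow_mul, Nat.reduceMul]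
      rw [hy4]
      have hf := fourth_nonneg (walshSign n) w
      calc _ ≤ fourth (walshSign n) w / 2 ^ n *
            (3 * (2 ^ n : ℕ) / k ^ 2 * (∑ i, v i ^ 2) ^ 2) :=
            mul_le_mul_of_nonneg_left h4 (by positivity)
        _ = 3 * (fourth (walshSign n) w / k ^ 2 * (∑ i, v i ^ 2) ^ 2) := by
            push_cast; field_simp
        _ ≤ 9 * (fourth (walshSign n) w / k ^ 2 * (∑ i, v i ^ 2) ^ 2) := by
            gcongr; norm_num
        _ = _ := by
            rw [mul_pow, div_pow, mul_pow, Real.sq_sqrt hf]; ring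
    exact (abs_le_of_sq_le_sq' h5 (by positivity)).2
  -- For `k ≤ 3` there are no four rows and independence says nothing. The columns of `B` are unit
  -- vectors, so the operator bound 1 is trivial, and `3 √N / k ≥ 1` because `N ≥ 1`.
  · have hk3 : (k : ℝ) ≤ 3 := by exact_mod_cast (by omega : k ≤ 3)
    have h1 : ∀ j, (∑ i, B i j * v i) ^ 2 ≤ ∑ i, v i ^ 2 := by
      intro j
      refine (Finset.sum_mul_sq_le_sq_mul_sq _ _ _).trans (le_of_eq ?_)
      simp only [hB.sq_eq]
      simp [hk0.ne']
    calc _ ≤ ∑ j, y j ^ 2 * ∑ i, v i ^ 2 :=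
          Finset.sum_le_sum fun j _ => mul_le_mul_of_nonneg_left (h1 j) (sq_nonneg _)
      _ = 1 * ∑ i, v i ^ 2 := by rw [← Finset.sum_mul, hy2]
      _ ≤ _ := by
          refine mul_le_mul_of_nonneg_right ?_ hv0
          rw [le_div_iff₀ hk0, one_mul]
          have := Real.one_le_sqrt.2 hN1
          linarith

open Classical in
/-- The deviation of the norm for a fixed outcome of the inner signs. -/
lemma IsFourWiseIndependent.expect_deviation_le (hB : IsFourWiseIndependent B) (hk : 1 ≤ k)
    {w : Fin (2 ^ n) → ℝ} (hw : ∑ a, w a ^ 2 = 1) {y : Fin (2 ^ n) → ℝ}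
    (hy : ∀ j, y j = (√(2 ^ n : ℝ))⁻¹ * ∑ a, walshSign n j a * w a) {t : ℝ} (ht : 0 < t)
    {L : ℝ} (hL : 3 * √(fourth (walshSign n) w) / k ≤ L) (hL0 : 0 < L) :
    𝔼 s : Fin (2 ^ n) → Bool,
      (if |√(∑ i, (∑ j, B i j * y j * sgn (s j)) ^ 2) - 1| > t then (1 : ℝ) else 0) ≤
      2 * Real.exp (-(t ^ 2 / (64 * L))) := by
  have hk0 : (0 : ℝ) < k := by exact_mod_cast hk
  have hd0 : (0 : ℝ) < 2 ^ n := by positivity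
  refine expect_norm_deviation_le (M := fun i j => B i j * y j) hL0 (fun v => ?_) ?_ ht
  · refine (hB.operator_bound hk hw hy v).trans ?_
    exact mul_le_mul_of_nonneg_right hL (by positivity)
  · have hy2 : ∑ j, y j ^ 2 = 1 := by
      have := (isFlatKernel_walshSign n).parseval w
      rw [hw, Fintype.expect_eq_sum_div_card] at this
      simp only [hy, mul_pow, ← Finset.mul_sum, inv_pow, Real.sq_sqrt hd0.le]
      simpa [div_eq_inv_mul] using this
    simp only [mul_pow, hB.sq_eq, ← Finset.mul_sum, hy2]
    simp [hk0.ne']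

lemma mulVec_apply_eq_sum {m l : Type*} [Fintype l] (A : Matrix m l ℝ) (w : l → ℝ) (i : m) :
    A.mulVec w i = ∑ j, A i j * w j := rfl

lemma norm_jlMatrix_mulVec (B : Matrix (Fin k) (Fin (2 ^ n)) ℝ) (s s' : Fin (2 ^ n) → Bool)
    (x : Fin (2 ^ n) → ℝ) :
    ‖WithLp.toLp 2 ((jlMatrix B (fun j => sgn (s j)) (fun j => sgn (s' j))).mulVec x)‖ =
      √(∑ i, (∑ j, B i j * ((√(2 ^ n : ℝ))⁻¹ * ∑ a, walshSign n j a * (x a * sgn (s' a))) *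
        sgn (s j)) ^ 2) := by
  rw [EuclideanSpace.norm_eq]
  congr 1
  refine Finset.sum_congr rfl fun i _ => ?_
  rw [Real.norm_eq_abs, sq_abs]
  congr 1
  rw [jlMatrix, ← Matrix.mulVec_mulVec, ← Matrix.mulVec_mulVec, ← Matrix.mulVec_mulVec]
  refine (mulVec_apply_eq_sum B _ i).trans (Finset.sum_congr rfl fun j _ => ?_)
  rw [Matrix.mulVec_diagonal, mul_assoc, mul_comm (sgn (s j))]
  congr 2
  rw [mulVec_apply_eq_sum, Finset.mul_sum]
  refine Finset.sum_congr rfl fun a _ => ?_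
  rw [Matrix.mulVec_diagonal, walshHadamard_eq, walshSign, mul_comm (sgn (s' a)), mul_assoc]

/-- The rate in the tail bound. -/
noncomputable def tailConst : ℝ := 1 / (192 * √(momConst * Real.exp 1))

lemma one_le_momConst_mul_exp : 1 ≤ momConst * Real.exp 1 := by
  have h1 : 1 ≤ momConst := by
    have : 0 < recConst := by unfold recConst; positivity
    unfold momConst
    nlinarith [sq_nonneg recConst]
  have h2 : 1 ≤ Real.exp 1 := Real.one_le_exp zero_le_one
  nlinarith

lemma tailConst_pos : 0 < tailConst := by
  have := one_le_momConst_mul_exp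
  unfold tailConst
  positivity

lemma tailConst_le_half : tailConst ≤ 1 / 2 := by
  have h1 : 1 ≤ √(momConst * Real.exp 1) := Real.one_le_sqrt.2 one_le_momConst_mul_exp
  unfold tailConst
  gcongr
  linarith

open Classical in
/-- The tail bound for uniformly distributed sign vectors. -/
theorem IsFourWiseIndependent.expect_tail_le (hB : IsFourWiseIndependent B)
    {x : Fin (2 ^ n) → ℝ} (hx : ∑ a, x a ^ 2 = 1) {t : ℝ} (ht : 0 < t) :
    𝔼 s' : Fin (2 ^ n) → Bool, 𝔼 s : Fin (2 ^ n) → Bool,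
      (if |‖WithLp.toLp 2 ((jlMatrix B (fun j => sgn (s j)) (fun j => sgn (s' j))).mulVec x)‖ - 1|
        > t then (1 : ℝ) else 0) ≤
      3 * Real.exp (-tailConst * (k : ℝ) ^ (2 / 3 : ℝ) * t ^ (4 / 3 : ℝ)) := by
  set r : ℝ := (k : ℝ) ^ (2 / 3 : ℝ) * t ^ (4 / 3 : ℝ) with hr
  have hr0 : 0 ≤ r := by positivity
  have hc := tailConst_pos
  have hc2 := tailConst_le_half
  rw [mul_assoc, ← hr]
  have hind1 : ∀ s s' : Fin (2 ^ n) → Bool, (if |‖WithLp.toLp 2 ((jlMatrix B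
      (fun j => sgn (s j)) (fun j => sgn (s' j))).mulVec x)‖ - 1| > t then (1 : ℝ) else 0) ≤ 1 :=
    fun s s' => by split_ifs <;> norm_num
  -- For `r < 1` the right side is at least `3 (1 - 1/2) > 1`, since `tailConst ≤ 1/2`. This also
  -- disposes of `k = 0`, where `r = 0`.
  rcases lt_or_ge r 1 with hr1 | hr1
  · refine le_trans (Finset.expect_le Finset.univ_nonempty fun s' _ =>
      Finset.expect_le Finset.univ_nonempty fun s _ => hind1 s s') ?_
    have := Real.add_one_le_exp (-tailConst * r)
    nlinarith
  have hk : 1 ≤ k := by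
    by_contra hk
    have : k = 0 := by omega
    subst this
    have : r = 0 := by
      rw [hr, Nat.cast_zero, Real.zero_rpow (by norm_num), zero_mul]
    linarith
  have hk0 : (0 : ℝ) < k := by exact_mod_cast hk
  set p := ⌊r⌋₊ with hp
  have hp1 : 1 ≤ p := Nat.one_le_floor_iff r |>.2 hr1
  have hpr : (p : ℝ) ≤ r := Nat.floor_le hr0
  have hp1' : (1 : ℝ) ≤ p := by exact_mod_cast hp1
  have hrp : r ≤ 2 * p := by
    have := Nat.lt_floor_add_one r
    rw [← hp] at this
    linarith
  set q := momConst * Real.exp 1 with hq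
  have hq1 : 1 ≤ q := one_le_momConst_mul_exp
  -- The balance that dictates the exponents `2/3` and `4/3`: with `L = 3 √(q r) / k`, the exponent
  -- `t² / (64 L)` becomes `r / (192 √q)`.
  have hrr : t ^ 2 * k = r * √r := by
    have h3 : r ^ 3 = (t ^ 2 * k) ^ 2 := by
      rw [hr, mul_pow, ← Real.rpow_natCast, ← Real.rpow_natCast, ← Real.rpow_mul hk0.le,
        ← Real.rpow_mul ht.le]
      norm_num
      ring
    have h4 : (r * √r) ^ 2 = r ^ 3 := by
      rw [mul_pow, Real.sq_sqrt hr0]; ring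
    exact (pow_left_inj₀ (by positivity) (by positivity) two_ne_zero).1 (h3.symm.trans h4.symm)
  have hw : ∀ s' : Fin (2 ^ n) → Bool, ∑ a, (x a * sgn (s' a)) ^ 2 = 1 := by
    intro s'
    simpa only [mul_pow, sgn_sq, mul_one] using hx
  set N : (Fin (2 ^ n) → Bool) → ℝ := fun s' =>
    fourth (walshSign n) fun a => x a * sgn (s' a) with hN
  have hinner : ∀ s' : Fin (2 ^ n) → Bool, 𝔼 s : Fin (2 ^ n) → Bool,
      (if |‖WithLp.toLp 2 ((jlMatrix B (fun j => sgn (s j)) (fun j => sgn (s' j))).mulVec x)‖ - 1|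
        > t then (1 : ℝ) else 0) ≤
      (if q * p < N s' then (1 : ℝ) else 0) + 2 * Real.exp (-tailConst * r) := by
    intro s'
    by_cases hs : q * p < N s'
    · rw [if_pos hs]
      have : 𝔼 s : Fin (2 ^ n) → Bool, (if |‖WithLp.toLp 2 ((jlMatrix B (fun j => sgn (s j))
          (fun j => sgn (s' j))).mulVec x)‖ - 1| > t then (1 : ℝ) else 0) ≤ 1 :=
        Finset.expect_le Finset.univ_nonempty fun s _ => hind1 s s'
      have h2 := Real.exp_pos (-tailConst * r)
      linarith
    · rw [if_neg hs, zero_add]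
      push Not at hs
      have hqr : N s' ≤ q * r := hs.trans (mul_le_mul_of_nonneg_left hpr (by linarith))
      have hqr0 : 0 < √(q * r) := Real.sqrt_pos.2 (by positivity)
      simp only [norm_jlMatrix_mulVec]
      refine (hB.expect_deviation_le hk (hw s') (fun j => rfl) ht (L := 3 * √(q * r) / k) ?_
        (by positivity)).trans (le_of_eq ?_)
      · have := Real.sqrt_le_sqrt hqr
        gcongr
      · congr 2
        rw [neg_mul, neg_inj, tailConst, ← hq]
        have hsq : √(q * r) = √q * √r := Real.sqrt_mul (by linarith) _
        have h1 : 0 < √q := Real.sqrt_pos.2 (by linarith)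
        have h2 : 0 < √r := Real.sqrt_pos.2 (by linarith)
        rw [hsq]
        field_simp
        linear_combination 192 * hrr
  calc _ ≤ 𝔼 s' : Fin (2 ^ n) → Bool,
        ((if q * p < N s' then (1 : ℝ) else 0) + 2 * Real.exp (-tailConst * r)) :=
        Finset.expect_le_expect fun s' _ => hinner s'
    _ ≤ Real.exp (-p) + 2 * Real.exp (-tailConst * r) := by
        rw [Finset.expect_add_distrib, Fintype.expect_const]
        gcongr
        exact expect_fourth_tail_le (isFlatKernel_walshSign n) hx.le hp1
    _ ≤ 3 * Real.exp (-tailConst * r) := by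
        have : Real.exp (-p) ≤ Real.exp (-tailConst * r) := Real.exp_le_exp.2 (by nlinarith)
        linarith

end Tail

/-! ### From Rademacher variables to uniform sign patterns. -/

section Rademacher

variable {Ω ι : Type*} [MeasurableSpace Ω] [Fintype ι] [DecidableEq ι] {P : Measure Ω}
  [IsProbabilityMeasure P]

omit [Fintype ι] [DecidableEq ι] in
lemma IsRademacher.ae_eq {ξ : ι → Ω → ℝ} (hξ : IsRademacher P ξ) (i : ι) :
    ∀ᵐ ω ∂P, ξ i ω = 1 ∨ ξ i ω = -1 := by
  have hm1 : MeasurableSet {ω | ξ i ω = 1} := hξ.1 i (measurableSet_singleton 1)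
  have hm2 : MeasurableSet {ω | ξ i ω = -1} := hξ.1 i (measurableSet_singleton (-1))
  have hd : Disjoint {ω | ξ i ω = 1} {ω | ξ i ω = -1} := by
    rw [Set.disjoint_left]
    intro ω h1 h2
    simp only [Set.mem_ofPred_eq] at h1 h2
    linarith
  have : P ({ω | ξ i ω = 1} ∪ {ω | ξ i ω = -1}) = 1 := by
    rw [measure_union hd hm2, (hξ.2.2 i).1, (hξ.2.2 i).2, one_div, ENNReal.inv_two_add_inv_two]
  exact (prob_compl_eq_zero_iff (hm1.union hm2)).2 this

omit [DecidableEq ι] [IsProbabilityMeasure P] in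
lemma IsRademacher.measure_pattern {ξ : ι → Ω → ℝ} (hξ : IsRademacher P ξ) (s : ι → Bool) :
    P {ω | ∀ i, ξ i ω = sgn (s i)} = (1 / 2) ^ Fintype.card ι := by
  have h := hξ.2.1.measure_inter_preimage_eq_mul Finset.univ (sets := fun i => {sgn (s i)})
    fun i _ => measurableSet_singleton _
  have e : {ω | ∀ i, ξ i ω = sgn (s i)} = ⋂ i ∈ Finset.univ, ξ i ⁻¹' {sgn (s i)} := by
    ext ω; simp
  rw [e, h]
  have : ∀ i, P (ξ i ⁻¹' {sgn (s i)}) = 1 / 2 := by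
    intro i
    cases s i
    · exact (hξ.2.2 i).1
    · exact (hξ.2.2 i).2
  simp [this]

open Classical in
/-- Independent Rademacher sequences are distributed like uniform sign vectors. -/
lemma measureReal_le_expect {ξ ξ' : ι → Ω → ℝ} (hξ : IsRademacher P ξ) (hξ' : IsRademacher P ξ')
    (hind : IndepFun (fun ω j => ξ j ω) (fun ω j => ξ' j ω) P)
    (p : (ι → ℝ) → (ι → ℝ) → Prop) :
    P.real {ω | p (fun j => ξ j ω) fun j => ξ' j ω} ≤
      𝔼 s' : ι → Bool, 𝔼 s : ι → Bool,
        if p (fun j => sgn (s j)) fun j => sgn (s' j) then (1 : ℝ) else 0 := by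
  set A : (ι → Bool) × (ι → Bool) → Set Ω := fun q =>
    {ω | ∀ i, ξ i ω = sgn (q.1 i)} ∩ {ω | ∀ i, ξ' i ω = sgn (q.2 i)} with hA
  set T : Finset ((ι → Bool) × (ι → Bool)) :=
    univ.filter fun q => p (fun j => sgn (q.1 j)) fun j => sgn (q.2 j) with hT
  -- The predicate `p` need not be measurable: up to a null set the event lies in a finite union of
  -- pattern events, whose probabilities are known.
  have hsub : {ω | p (fun j => ξ j ω) fun j => ξ' j ω} ≤ᵐ[P] ⋃ q ∈ T, A q := by
    have h1 : ∀ᵐ ω ∂P, ∀ i, ξ i ω = 1 ∨ ξ i ω = -1 := ae_all_iff.2 hξ.ae_eq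
    have h2 : ∀ᵐ ω ∂P, ∀ i, ξ' i ω = 1 ∨ ξ' i ω = -1 := ae_all_iff.2 hξ'.ae_eq
    filter_upwards [h1, h2] with ω h1 h2 hω
    have hs : ∀ {f : ι → ℝ}, (∀ i, f i = 1 ∨ f i = -1) →
        ∀ i, f i = sgn (decide (f i = -1)) := by
      intro f hf i
      rcases hf i with h | h <;> rw [h] <;> norm_num [sgn]
    have e1 := hs h1
    have e2 := hs h2
    refine Set.mem_biUnion (x := (fun i => decide (ξ i ω = -1), fun i => decide (ξ' i ω = -1)))
      ?_ ⟨e1, e2⟩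
    simp only [hT, Finset.coe_filter, Finset.mem_univ, true_and, Set.mem_ofPred_eq]
    rw [← funext e1, ← funext e2]
    exact hω
  have hmeas : ∀ q, P.real (A q) = (1 / 2) ^ Fintype.card ι * (1 / 2) ^ Fintype.card ι := by
    intro q
    have h := hind.measure_inter_preimage_eq_mul {f | ∀ i, f i = sgn (q.1 i)}
      {f | ∀ i, f i = sgn (q.2 i)} ?_ ?_
    · change P.real ((fun ω j => ξ j ω) ⁻¹' {f | ∀ i, f i = sgn (q.1 i)} ∩
        (fun ω j => ξ' j ω) ⁻¹' {f | ∀ i, f i = sgn (q.2 i)}) = _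
      rw [measureReal_def, h]
      have h1 := hξ.measure_pattern q.1
      have h2 := hξ'.measure_pattern q.2
      simp only [Set.preimage_ofPred_eq]
      rw [h1, h2]
      simp
    · rw [Set.ofPred_forall]
      exact MeasurableSet.iInter fun i => measurable_pi_apply i (measurableSet_singleton _)
    · rw [Set.ofPred_forall]
      exact MeasurableSet.iInter fun i => measurable_pi_apply i (measurableSet_singleton _)
  calc P.real {ω | p (fun j => ξ j ω) fun j => ξ' j ω} ≤ P.real (⋃ q ∈ T, A q) :=
        ENNReal.toReal_mono (measure_ne_top _ _) (measure_mono_ae hsub)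
    _ ≤ ∑ q ∈ T, P.real (A q) := measureReal_biUnion_finset_le _ _
    _ = _ := by
        simp only [hmeas]
        rw [← Finset.expect_product' (s := univ) (t := univ)
          (f := fun s' s : ι → Bool => if p (fun j => sgn (s j)) fun j => sgn (s' j)
            then (1 : ℝ) else 0), Finset.univ_product_univ,
          ← Fintype.expect_equiv (Equiv.prodComm (ι → Bool) (ι → Bool))
            (fun q => if p (fun j => sgn (q.1 j)) fun j => sgn (q.2 j) then (1 : ℝ) else 0) _
            (fun q => rfl),
          Fintype.expect_eq_sum_div_card, ← Finset.sum_filter, ← hT]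
        simp
        field_simp

end Rademacher

/-! ### Straight-line programs and the fast Walsh–Hadamard transform. -/

section Programs

variable {ι κ τ : Type*}

/-- A map is computed by straight-line programs with at most `T` instructions, wherever its input
is stored. -/
def HasProgram (f : (ι → ℝ) → κ → ℝ) (T : ℕ) : Prop :=
  ∀ src : ι → ℕ, ∃ (p : List Instr) (out : κ → ℕ), p.length ≤ T ∧
    ∀ σ i, run p σ (out i) = f (fun j => σ (src j)) i

lemma run_append (p q : List Instr) (σ : ℕ → ℝ) : run (p ++ q) σ = run q (run p σ) := by
  simp [run, List.foldl_append]

lemma HasProgram.comp {f : (ι → ℝ) → κ → ℝ} {g : (κ → ℝ) → τ → ℝ} {S T : ℕ}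
    (hg : HasProgram g T) (hf : HasProgram f S) : HasProgram (fun x => g (f x)) (S + T) := by
  intro src
  obtain ⟨p, out, hp, hf⟩ := hf src
  obtain ⟨q, out', hq, hg⟩ := hg out
  refine ⟨p ++ q, out', by rw [List.length_append]; omega, fun σ i => ?_⟩
  rw [run_append, hg]
  simp only [hf]

lemma HasProgram.mono {f : (ι → ℝ) → κ → ℝ} {S T : ℕ} (hf : HasProgram f S) (h : S ≤ T) :
    HasProgram f T := fun src =>
  let ⟨p, out, hp, hf⟩ := hf src
  ⟨p, out, hp.trans h, hf⟩

lemma hasProgram_reindex (r : κ → ι) : HasProgram (fun x i => x (r i)) 0 := fun src =>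
  ⟨[], fun i => src (r i), le_rfl, fun _ _ => rfl⟩

/-- A function computed by a single instruction. -/
def IsBasic (g : (ι → ℝ) → ℝ) : Prop :=
  (∃ a b, ∀ x, g x = x a + x b) ∨ (∃ a b, ∀ x, g x = x a - x b) ∨ ∃ c a, ∀ x, g x = c * x a

lemma IsBasic.exists_instr {g : (ι → ℝ) → ℝ} (hg : IsBasic g) (src : ι → ℕ) (dst : ℕ) :
    ∃ I : Instr, ∀ σ, I.exec σ = Function.update σ dst (g fun j => σ (src j)) := by
  rcases hg with ⟨a, b, h⟩ | ⟨a, b, h⟩ | ⟨c, a, h⟩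
  · exact ⟨.add dst (src a) (src b), fun σ => by simp [Instr.exec, h]⟩
  · exact ⟨.sub dst (src a) (src b), fun σ => by simp [Instr.exec, h]⟩
  · exact ⟨.smul dst c (src a), fun σ => by simp [Instr.exec, h]⟩

/-- One instruction for every coordinate of the output. -/
lemma hasProgram_layer [Finite ι] [Fintype κ] {f : (ι → ℝ) → κ → ℝ}
    (hf : ∀ i, IsBasic fun x => f x i) : HasProgram f (Fintype.card κ) := by
  classical
  intro src
  obtain ⟨N, hN⟩ := (Set.finite_range src).bddAbove
  have hN : ∀ j, src j < N + 1 := fun j => Nat.lt_succ_of_le (hN ⟨j, rfl⟩)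
  set e := Fintype.equivFin κ
  -- All outputs go to registers above every input register, so no instruction destroys an operand
  -- of a later one.
  set out : κ → ℕ := fun i => N + 1 + e i with hout
  have hinj : Function.Injective out := fun i j hij => by
    have : (e i : ℕ) = e j := by simp only [hout] at hij; omega
    exact e.injective (Fin.ext this)
  have hne : ∀ i j, src j ≠ out i := fun i j h => by
    have := hN j
    simp only [hout] at h
    omega
  choose I hI using fun i => (hf i).exists_instr src (out i)
  have hkeep : ∀ (l : List κ) (σ : ℕ → ℝ) (r : ℕ), (∀ i ∈ l, r ≠ out i) →
      run (l.map I) σ r = σ r := by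
    intro l
    induction l with
    | nil => intros; rfl
    | cons c l ih =>
      intro σ r hr
      change run (l.map I) ((I c).exec σ) r = _
      rw [ih _ _ fun i hi => hr i (List.mem_cons_of_mem _ hi), hI,
        Function.update_of_ne (hr c List.mem_cons_self)]
  have hval : ∀ (l : List κ), l.Nodup → ∀ (σ : ℕ → ℝ), ∀ i ∈ l,
      run (l.map I) σ (out i) = f (fun j => σ (src j)) i := by
    intro l
    induction l with
    | nil => simp
    | cons c l ih =>
      intro hl σ i hi
      rw [List.nodup_cons] at hl
      change run (l.map I) ((I c).exec σ) (out i) = _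
      rcases List.mem_cons.1 hi with rfl | hi
      · rw [hkeep _ _ _ fun j hj h => hl.1 (by rwa [← hinj h] at hj), hI, Function.update_self]
      · rw [ih hl.2 _ i hi]
        congr 1
        ext j
        rw [hI, Function.update_of_ne (hne c j)]
  refine ⟨(Finset.univ : Finset κ).toList.map I, out, by simp, fun σ i => ?_⟩
  exact hval _ (Finset.nodup_toList _) σ i (by simp)

lemma hasProgram_smul [Fintype κ] [Finite ι] (c : κ → ℝ) (r : κ → ι) :
    HasProgram (fun x i => c i * x (r i)) (Fintype.card κ) :=
  hasProgram_layer fun i => Or.inr (Or.inr ⟨c i, r i, fun _ => rfl⟩)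

/-- The kernel of the Walsh–Hadamard transform in the coordinates from `S`. -/
noncomputable def partialChi {ι : Type*} [Fintype ι] [DecidableEq ι] (S : Finset ι)
    (u w : ι → ZMod 2) : ℝ :=
  ∏ b, if b ∈ S then psi (u b * w b) else if u b = w b then 1 else 0

/-- One butterfly of the fast transform. Outside `S` the kernel is the identity, so setting digit
`b` of `u` to `z` selects the `w` with `w b = z`; the new digit then contributes the sign `psi (u b
* z)`. -/
lemma partialChi_insert {ι : Type*} [Fintype ι] [DecidableEq ι] {S : Finset ι} {b : ι}
    (hb : b ∉ S) (u w : ι → ZMod 2) :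
    partialChi (insert b S) u w = partialChi S (Function.update u b 0) w +
      psi (u b) * partialChi S (Function.update u b 1) w := by
  simp only [partialChi]
  rw [← Finset.mul_prod_erase univ _ (Finset.mem_univ b),
    ← Finset.mul_prod_erase univ (fun c => if c ∈ S then
      psi (Function.update u b 0 c * w c) else _) (Finset.mem_univ b),
    ← Finset.mul_prod_erase univ (fun c => if c ∈ S then
      psi (Function.update u b 1 c * w c) else _) (Finset.mem_univ b)]
  have h : ∀ z : ZMod 2, ∏ c ∈ univ.erase b, (if c ∈ S then
      psi (Function.update u b z c * w c) else if Function.update u b z c = w c then 1 else 0) =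
      ∏ c ∈ univ.erase b, (if c ∈ insert b S then psi (u c * w c) else
        if u c = w c then 1 else 0) := by
    intro z
    refine Finset.prod_congr rfl fun c hc => ?_
    have hcb := Finset.ne_of_mem_erase hc
    simp [hcb]
  rw [h, h, ← mul_assoc, ← add_mul]
  congr 1
  rcases zmod_two_cases (w b) with hw | hw <;> simp [hb, hw]

/-- The fast Walsh–Hadamard transform, applied to a family of vectors. -/
lemma hasProgram_walsh {ι V : Type*} [Fintype ι] [DecidableEq ι] [Fintype V] :
    HasProgram (fun (x : (ι → ZMod 2) × V → ℝ) (q : (ι → ZMod 2) × V) =>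
      ∑ w, chi q.1 w * x (w, q.2)) (Fintype.card ι * (2 ^ Fintype.card ι * Fintype.card V)) := by
  have key : ∀ S : Finset ι, HasProgram (fun (x : (ι → ZMod 2) × V → ℝ) (q : (ι → ZMod 2) × V) =>
      ∑ w, partialChi S q.1 w * x (w, q.2))
      (S.card * (2 ^ Fintype.card ι * Fintype.card V)) := by
    intro S
    induction S using Finset.induction_on with
    | empty =>
      convert! hasProgram_reindex (id : (ι → ZMod 2) × V → (ι → ZMod 2) × V) using 1
      · funext x q
        rw [Finset.sum_eq_single q.1]
        · simp [partialChi]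
        · intro w _ hw
          obtain ⟨b, hb⟩ := Function.ne_iff.1 hw
          have : partialChi ∅ q.1 w = 0 :=
            Finset.prod_eq_zero (Finset.mem_univ b) (by simp [Ne.symm hb])
          rw [this, zero_mul]
        · simp
      · simp
    | insert b S hb ih =>
      have hl : HasProgram (fun (x : (ι → ZMod 2) × V → ℝ) (q : (ι → ZMod 2) × V) =>
          x (Function.update q.1 b 0, q.2) + psi (q.1 b) * x (Function.update q.1 b 1, q.2))
          (2 ^ Fintype.card ι * Fintype.card V) := by
        have hc : Fintype.card ((ι → ZMod 2) × V) = 2 ^ Fintype.card ι * Fintype.card V := by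
          simp
        rw [← hc]
        refine hasProgram_layer fun q => ?_
        rcases zmod_two_cases (q.1 b) with h | h
        · exact Or.inl ⟨(Function.update q.1 b 0, q.2), (Function.update q.1 b 1, q.2),
            fun x => by rw [h]; simp⟩
        · exact Or.inr (Or.inl ⟨(Function.update q.1 b 0, q.2), (Function.update q.1 b 1, q.2),
            fun x => by rw [h]; simp [sub_eq_add_neg]⟩)
      convert! hl.comp ih using 1
      · funext x q
        rw [Finset.mul_sum, ← Finset.sum_add_distrib]
        refine Finset.sum_congr rfl fun w _ => ?_
        rw [partialChi_insert hb]
        ring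
      · rw [Finset.card_insert_of_notMem hb]; ring
  have := key univ
  simpa [partialChi, chi, Finset.card_univ] using this

/-- Summation over the second coordinate. -/
lemma hasProgram_sum {U : Type*} [Fintype U] (m : ℕ) :
    HasProgram (fun (x : U × (Fin m → ZMod 2) → ℝ) (u : U) => ∑ v, x (u, v))
      (2 ^ m * Fintype.card U) := by
  induction m with
  | zero =>
    refine HasProgram.mono ?_ (Nat.zero_le _)
    convert! hasProgram_reindex (fun u : U => (u, (default : Fin 0 → ZMod 2))) using 1
    funext x u
    rw [Fintype.sum_unique]
    exact congrArg (fun v => x (u, v)) (Subsingleton.elim _ _)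
  | succ m ih =>
    have hl : HasProgram (fun (x : U × (Fin (m + 1) → ZMod 2) → ℝ) (q : U × (Fin m → ZMod 2)) =>
        x (q.1, Fin.cons 0 q.2) + x (q.1, Fin.cons 1 q.2)) (2 ^ m * Fintype.card U) := by
      have hc : Fintype.card (U × (Fin m → ZMod 2)) = 2 ^ m * Fintype.card U := by
        simp [mul_comm]
      rw [← hc]
      exact hasProgram_layer fun q =>
        Or.inl ⟨(q.1, Fin.cons 0 q.2), (q.1, Fin.cons 1 q.2), fun x => rfl⟩
    convert! ih.comp hl using 1
    · funext x u
      rw [← (Fin.consEquiv fun _ : Fin (m + 1) => ZMod 2).sum_comp, Fintype.sum_prod_type,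
        sum_zmod_two, ← Finset.sum_add_distrib]
      rfl
    · ring

end Programs

/-! ### Fast application of `B D H D'`. -/

section JLProgram

/-- The digits of a number below `2 ^ (l + m)`, split into `l` and `m` digits. -/
noncomputable def splitBits (l m : ℕ) :
    Fin (2 ^ (l + m)) ≃ (Fin l → ZMod 2) × (Fin m → ZMod 2) :=
  (bits (l + m)).trans (Fin.appendEquiv l m).symm

lemma chi_append {l m : ℕ} (u u' : Fin l → ZMod 2) (v v' : Fin m → ZMod 2) :
    chi (Fin.append u v) (Fin.append u' v') = chi u u' * chi v v' := by
  simp [chi, Fin.prod_univ_add]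

lemma walshHadamard_eq_split (l m : ℕ) (i j : Fin (2 ^ (l + m))) :
    walshHadamard (l + m) i j = (√(2 ^ (l + m) : ℝ))⁻¹ *
      (chi (splitBits l m i).1 (splitBits l m j).1 *
        chi (splitBits l m i).2 (splitBits l m j).2) := by
  rw [walshHadamard_eq, ← chi_append]
  have h : ∀ i, Fin.append (splitBits l m i).1 (splitBits l m i).2 = bits (l + m) i := fun i =>
    (Fin.appendEquiv l m).apply_symm_apply (bits (l + m) i)
  rw [h, h]

/-- The product `B D H D'` can be applied fast if the rows of `B` only depend on the first `l`
binary digits of the column number. -/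
lemma hasProgram_jlMatrix {k l m : ℕ} {B : Matrix (Fin k) (Fin (2 ^ (l + m))) ℝ}
    {ρ : Fin k → Fin l → ZMod 2} {c : ℝ}
    (hB : ∀ i j, B i j = c * chi (ρ i) (splitBits l m j).1) (s s' : Fin (2 ^ (l + m)) → ℝ) :
    HasProgram (fun x => (jlMatrix B s s').mulVec x) ((2 * l + 3) * 2 ^ (l + m)) := by
  set θ := splitBits l m with hθ
  set c' := (√(2 ^ (l + m) : ℝ))⁻¹ with hc'
  -- As `B` ignores the last `m` digits `v`, the sum over `v` involves only `D` and the last-digit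
  -- factor of `H`. It is a constant of the program, since the program may depend on the signs.
  set C : (Fin l → ZMod 2) × (Fin m → ZMod 2) → ℝ := fun q =>
    c * c' * ∑ v, s (θ.symm (q.1, v)) * chi v q.2 with hC
  have h1 := hasProgram_smul (fun q => s' (θ.symm q)) (fun q => θ.symm q)
  have h2 := hasProgram_walsh (ι := Fin l) (V := Fin m → ZMod 2)
  have h3 := hasProgram_smul C id
  have h4 := hasProgram_sum (U := Fin l → ZMod 2) m
  have h5 := hasProgram_reindex fun q : (Fin l → ZMod 2) × Unit => q.1
  have h6 := hasProgram_walsh (ι := Fin l) (V := Unit)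
  have h7 := hasProgram_reindex fun i : Fin k => (ρ i, ())
  -- From the inside: apply `D'`, transform the first `l` digits, multiply by `C`, sum over the last
  -- `m` digits, transform the `l` digits again, select the rows. The cost is `d + l d + d + d + l 2
  -- ^ l` with `d = 2 ^ (l + m)`.
  have h := h7.comp (h6.comp (h5.comp (h4.comp (h3.comp (h2.comp h1)))))
  have h' := h.mono (T := (2 * l + 3) * 2 ^ (l + m)) (by
    simp only [Fintype.card_prod, Fintype.card_fun, ZMod.card, Fintype.card_fin,
      Fintype.card_unit, mul_one]
    have h8 : l * 2 ^ l ≤ l * 2 ^ (l + m) :=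
      Nat.mul_le_mul_left _ (Nat.pow_le_pow_right two_pos (Nat.le_add_right _ _))
    have h9 : 2 ^ l * 2 ^ m = 2 ^ (l + m) := (pow_add 2 l m).symm
    rw [h9, mul_comm (2 ^ m) (2 ^ l), h9]
    linarith)
  convert! h' using 1
  funext x i
  rw [jlMatrix, ← Matrix.mulVec_mulVec, ← Matrix.mulVec_mulVec, ← Matrix.mulVec_mulVec,
    mulVec_apply_eq_sum]
  simp only [Matrix.mulVec_diagonal, id]
  rw [← θ.symm.sum_comp, Fintype.sum_prod_type]
  refine Finset.sum_congr rfl fun u _ => ?_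
  have e1 : ∀ v, (walshHadamard (l + m)).mulVec ((Matrix.diagonal s').mulVec x)
      (θ.symm (u, v)) = ∑ v', chi v v' * (c' * ∑ w, chi u w *
        (s' (θ.symm (w, v')) * x (θ.symm (w, v')))) := by
    intro v
    rw [mulVec_apply_eq_sum, ← θ.symm.sum_comp, Fintype.sum_prod_type, Finset.sum_comm]
    refine Finset.sum_congr rfl fun v' _ => ?_
    rw [Finset.mul_sum, Finset.mul_sum]
    refine Finset.sum_congr rfl fun w _ => ?_
    rw [Matrix.mulVec_diagonal, walshHadamard_eq_split, ← hθ, Equiv.apply_symm_apply,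
      Equiv.apply_symm_apply]
    ring
  simp only [e1, hB, Equiv.apply_symm_apply, hC, Finset.mul_sum, Finset.sum_mul]
  rw [Finset.sum_comm]
  refine Finset.sum_congr rfl fun v' _ => ?_
  rw [Finset.sum_comm]
  refine Finset.sum_congr rfl fun w _ => Finset.sum_congr rfl fun v _ => ?_
  ring

lemma HasProgram.computableInTime {d k T : ℕ} {f : (Fin d → ℝ) → Fin k → ℝ}
    (hf : HasProgram f T) {T' : ℝ} (hT : (T : ℝ) ≤ T') : ComputableInTime f T' := by
  obtain ⟨p, out, hp, h⟩ := hf fun j => j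
  refine ⟨p, out, le_trans (by exact_mod_cast hp) hT, fun x i => ?_⟩
  rw [h]
  congr 1
  ext j
  simp [input]

end JLProgram

/-! ### Code matrices from BCH codes. -/

section Code

/-- Rows of the Walsh–Hadamard matrix are 4-wise independent if at most four of them never add up
to zero. -/
lemma isFourWiseIndependent_of_sum_ne_zero {k n : ℕ} {B : Matrix (Fin k) (Fin (2 ^ n)) ℝ}
    (R : Fin k → Fin n → ZMod 2) (hR : ∀ S : Finset (Fin k), S.Nonempty → S.card ≤ 4 →
      ∑ i ∈ S, R i ≠ 0)
    (hB : ∀ i j, B i j = (√k)⁻¹ * chi (R i) (bits n j)) : IsFourWiseIndependent B := by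
  refine ⟨fun i j => ?_, fun i hi b hb => ?_⟩
  · rw [hB]
    rcases chi_eq_or (R i) (bits n j) with h | h <;> simp [h]
  · have hk : 0 < √(k : ℝ) := Real.sqrt_pos.2 (by exact_mod_cast (i 0).pos)
    have hiff : ∀ a j, B (i a) j = (√k)⁻¹ * b a ↔ chi (R (i a)) (bits n j) = b a := by
      intro a j
      rw [hB, mul_right_inj' (inv_ne_zero hk.ne')]
    simp only [hiff]
    rw [Nat.card_eq_fintype_card, Fintype.card_subtype]
    -- Each factor `1 + b χ` is 2 or 0, so the product is 16 times the indicator of the pattern.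
    -- Expanded, it is a combination of characters of subset sums of the rows, and only the empty
    -- subset has a nonzero total.
    have h1 : ∀ j, (if ∀ a, chi (R (i a)) (bits n j) = b a then (16 : ℝ) else 0) =
        ∏ a, (1 + b a * chi (R (i a)) (bits n j)) := by
      intro j
      have hf : ∀ a, 1 + b a * chi (R (i a)) (bits n j) =
          if chi (R (i a)) (bits n j) = b a then 2 else 0 := by
        intro a
        rcases hb a with h | h <;> rcases chi_eq_or (R (i a)) (bits n j) with h' | h' <;>
          rw [h, h'] <;> norm_num
      simp only [hf]
      split_ifs with hall
      · simp only [hall, if_true]; norm_num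
      · push Not at hall
        obtain ⟨a, ha⟩ := hall
        exact (Finset.prod_eq_zero (Finset.mem_univ a) (if_neg ha)).symm
    have h2 : ∑ j, ∏ a, (1 + b a * chi (R (i a)) (bits n j)) = (2 : ℝ) ^ n := by
      simp only [Finset.prod_one_add, Finset.prod_mul_distrib, ← chi_sum_left]
      rw [Finset.sum_comm, Finset.sum_eq_single ∅]
      · simp
      · intro T _ hT
        rw [← Finset.mul_sum, (bits n).sum_comp (chi (∑ a ∈ T, R (i a))), sum_chi, if_neg,
          mul_zero]
        have := hR (T.image i) ((Finset.nonempty_iff_ne_empty.2 hT).image i)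
          (Finset.card_image_le.trans (by simpa using Finset.card_le_univ T))
        rwa [Finset.sum_image hi.injective.injOn] at this
      · simp
    have h3 : (16 : ℝ) * (univ.filter fun j => ∀ a, chi (R (i a)) (bits n j) = b a).card =
        2 ^ n := by
      rw [← h2]
      simp only [← h1]
      rw [← Finset.sum_filter, Finset.sum_const, nsmul_eq_mul, mul_comm]
    exact_mod_cast h3

/-- The columns `(α, α ^ 3)` of the parity check matrix of the double-error-correcting BCH code. -/
lemma bch_sum_ne_zero {F : Type*} [Field F] [CharP F 2] {k : ℕ} {α : Fin k → F}
    (hinj : Function.Injective α) (h0 : ∀ i, α i ≠ 0) {S : Finset (Fin k)} (hS : S.Nonempty)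
    (hS4 : S.card ≤ 4) : ∑ i ∈ S, (α i, α i ^ 3) ≠ 0 := by
  intro h
  have h1 : ∑ i ∈ S, α i = 0 := by simpa [Prod.fst_sum] using congrArg Prod.fst h
  have h3 : ∑ i ∈ S, α i ^ 3 = 0 := by simpa [Prod.snd_sum] using congrArg Prod.snd h
  have h2 : (2 : F) = 0 := CharTwo.two_eq_zero
  have hne : ∀ {a b : Fin k}, a ≠ b → α a + α b ≠ 0 := fun hab h =>
    hab (hinj (CharTwo.add_eq_zero.1 h))
  have hpos := hS.card_pos
  rcases (by omega : S.card = 1 ∨ S.card = 2 ∨ S.card = 3 ∨ S.card = 4) with hc | hc | hc | hc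
  · obtain ⟨a, rfl⟩ := Finset.card_eq_one.1 hc
    exact h0 a (by simpa using h1)
  · obtain ⟨a, b, hab, rfl⟩ := Finset.card_eq_two.1 hc
    rw [Finset.sum_pair hab] at h1
    exact hne hab h1
  · obtain ⟨a, b, c, hab, hac, hbc, rfl⟩ := Finset.card_eq_three.1 hc
    rw [Finset.sum_insert (by simp [hab, hac]), Finset.sum_pair hbc] at h1 h3
    -- If `a + b + c = 0`, then `a³ + b³ + c³ = 3abc`, which is `abc` in characteristic 2.
    have : α a * α b * α c = 0 := by
      linear_combination h3 - ((α a + (α b + α c)) ^ 2 -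
        3 * (α a * α b + α b * α c + α c * α a)) * h1 - α a * α b * α c * h2
    simp [h0] at this
  · obtain ⟨a, T, haT, rfl, hT⟩ := Finset.card_eq_succ.1 hc
    obtain ⟨b, c, d, hbc, hbd, hcd, rfl⟩ := Finset.card_eq_three.1 hT
    rw [Finset.sum_insert haT, Finset.sum_insert (by simp [hbc, hbd]),
      Finset.sum_pair hcd] at h1 h3
    -- Eliminate `a` and use `(b + c + d)³ - b³ - c³ - d³ = 3 (b + c)(c + d)(d + b)`.
    have : (α b + α c) * (α c + α d) * (α d + α b) = 0 := by
      have e1 : α a = -(α b + (α c + α d)) := by linear_combination h1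
      rw [e1] at h3
      linear_combination (-1 : F) * h3 - (α b + α c) * (α c + α d) * (α d + α b) * h2
    rcases mul_eq_zero.1 this with h | h
    · rcases mul_eq_zero.1 h with h | h
      · exact hne hbc h
      · exact hne hcd h
    · exact hne hbd.symm h

/-- Vectors over `ZMod 2` no four of which are linearly dependent. -/
lemma exists_sum_ne_zero {k l : ℕ} (hk : 2 ≤ k) (hl : 4 * k ^ 2 ≤ 2 ^ l) :
    ∃ ρ : Fin k → Fin l → ZMod 2, ∀ S : Finset (Fin k), S.Nonempty → S.card ≤ 4 →
      ∑ i ∈ S, ρ i ≠ 0 := by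
  -- Pairs over the field with `2 ^ m` elements take `2 m ≤ l` binary digits. Rounding down loses at
  -- most a factor 2 in `2 ^ l`, and `4 k²` leaves room for it: there are still `k` distinct nonzero
  -- elements.
  set m := l / 2 with hm
  have h1 : 2 ^ l ≤ 2 * (2 ^ m * 2 ^ m) := by
    rw [← pow_add, ← pow_succ']
    exact Nat.pow_le_pow_right two_pos (by omega)
  have hkm : k < 2 ^ m := by
    by_contra! h
    have := Nat.mul_le_mul h h
    nlinarith
  have hm0 : m ≠ 0 := by
    rintro h
    rw [h] at hkm
    omega
  have : Fact (Nat.Prime 2) := ⟨Nat.prime_two⟩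
  let F := GaloisField 2 m
  have : Fintype F := Fintype.ofFinite F
  have hcard : Fintype.card F = 2 ^ m := by
    rw [← Nat.card_eq_fintype_card]
    exact GaloisField.card 2 m hm0
  classical
  have hemb : Nonempty (Fin k ↪ Fˣ) := by
    apply Function.Embedding.nonempty_of_card_le
    rw [Fintype.card_units, hcard, Fintype.card_fin]
    omega
  obtain ⟨u⟩ := hemb
  have hfr : Module.finrank (ZMod 2) (F × F) ≤ Module.finrank (ZMod 2) (Fin l → ZMod 2) := by
    rw [Module.finrank_prod, GaloisField.finrank 2 hm0, Module.finrank_fin_fun]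
    omega
  obtain ⟨φ, hφ⟩ := finrank_le_iff_exists_linearMap.1 hfr
  refine ⟨fun i => φ ((u i : F), (u i : F) ^ 3), fun S hS hS4 h => ?_⟩
  rw [← map_sum] at h
  exact bch_sum_ne_zero (α := fun i => (u i : F)) (fun i j hij => u.injective (Units.ext hij))
    (fun i => (u i).ne_zero) hS hS4 (hφ (h.trans (map_zero φ).symm))

end Code

/-! ### Choice of the code matrix and the operation count. -/

section Assembly

lemma sqrt_div_mul_inv_sqrt (k n : ℕ) :
    √((2 ^ n : ℝ) / k) * (√(2 ^ n : ℝ))⁻¹ = (√(k : ℝ))⁻¹ := by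
  have h : √(2 ^ n : ℝ) ≠ 0 := (Real.sqrt_pos.2 (by positivity)).ne'
  rw [Real.sqrt_div (by positivity)]
  field_simp

/-- The number of digits and the rows of a code matrix that admits a fast algorithm. -/
lemma exists_code_matrix {k n : ℕ} (hk : 2 ≤ k)
    (h : 4 * k ^ 2 ≤ 2 ^ n ∨ ∃ B₀ : Matrix (Fin k) (Fin (2 ^ n)) ℝ,
      IsFourWiseIndependent B₀ ∧ IsCodeMatrix B₀) :
    ∃ (l m : ℕ) (hn : n = l + m), 2 ^ l ≤ 8 * k ^ 2 ∧
      ∃ B : Matrix (Fin k) (Fin (2 ^ n)) ℝ, IsFourWiseIndependent B ∧ IsCodeMatrix B ∧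
        ∃ (ρ : Fin k → Fin l → ZMod 2) (c : ℝ),
          ∀ i j, B i j = c * chi (ρ i) (splitBits l m (Fin.cast (by rw [hn]) j)).1 := by
  by_cases hkn : 4 * k ^ 2 ≤ 2 ^ n
  · have hex : ∃ l, 4 * k ^ 2 ≤ 2 ^ l := ⟨n, hkn⟩
    -- The least admissible `l`, so that doubling overshoots `4 k²` by at most a factor 2.
    set l := Nat.find hex with hl
    have hl1 : 4 * k ^ 2 ≤ 2 ^ l := Nat.find_spec hex
    have hln : l ≤ n := Nat.find_min' hex hkn
    have hl2 : 2 ^ l ≤ 8 * k ^ 2 := by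
      rcases Nat.eq_zero_or_pos l with h0 | h0
      · rw [h0]; nlinarith
      · have := Nat.find_min hex (m := l - 1) (by omega)
        have e : 2 ^ l = 2 * 2 ^ (l - 1) := by rw [← pow_succ']; congr 1; omega
        omega
    obtain ⟨ρ, hρ⟩ := exists_sum_ne_zero hk hl1
    obtain ⟨m, rfl⟩ := Nat.exists_eq_add_of_le hln
    refine ⟨l, m, rfl, hl2, ?_⟩
    -- Padding the row labels by zeros in the last `m` digits makes the rows independent of those
    -- digits of the column.
    set r : Fin k → Fin (2 ^ (l + m)) := fun i => (splitBits l m).symm (ρ i, 0) with hr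
    have hBr : ∀ i j, √((2 ^ (l + m) : ℝ) / k) * walshHadamard (l + m) (r i) j =
        (√(k : ℝ))⁻¹ * chi (ρ i) (splitBits l m j).1 := by
      intro i j
      rw [walshHadamard_eq_split, hr, Equiv.apply_symm_apply, ← mul_assoc, sqrt_div_mul_inv_sqrt]
      simp
    refine ⟨fun i j => √((2 ^ (l + m) : ℝ) / k) * walshHadamard (l + m) (r i) j, ?_,
      fun i => ⟨r i, fun j => rfl⟩, ρ, (√(k : ℝ))⁻¹, fun i j => hBr i j⟩
    refine isFourWiseIndependent_of_sum_ne_zero (fun i => bits (l + m) (r i)) ?_ fun i j => by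
      rw [walshHadamard_eq, ← mul_assoc, sqrt_div_mul_inv_sqrt]
    intro S hS hS4 hsum
    refine hρ S hS hS4 ?_
    funext b
    have := congrFun hsum (Fin.castAdd m b)
    rw [Finset.sum_apply] at this ⊢
    refine Eq.trans (Finset.sum_congr rfl fun i _ => ?_) this
    have e : bits (l + m) (r i) = Fin.append (ρ i) 0 := by
      simp only [hr, splitBits, Equiv.symm_trans_apply, Equiv.symm_symm, Equiv.apply_symm_apply]
      rfl
    rw [e, Fin.append_left]
  · obtain ⟨B, hB, hC⟩ := h.resolve_left hkn
    choose r hr using hC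
    -- Here `2 ^ n < 4 k²`, so all `n` digits may be kept and the given matrix serves.
    refine ⟨n, 0, rfl, by omega, B, hB, fun i => ⟨r i, hr i⟩,
      fun i => (splitBits n 0 (r i)).1, (√(k : ℝ))⁻¹, fun i j => ?_⟩
    rw [hr]
    change _ * walshHadamard (n + 0) (r i) j = _
    rw [walshHadamard_eq_split n 0 (r i) j, ← mul_assoc]
    have e : (splitBits n 0 (r i)).2 = 0 := Subsingleton.elim _ _
    have e2 := sqrt_div_mul_inv_sqrt k n
    rw [e, chi_zero_left, mul_one]
    congr 1

/-- With logarithms to base 2, `l ≤ 3 + 2 log k`, hence `2 l + 3 ≤ 9 + 4 log k ≤ 13 log k` because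
`log k ≥ 1`. -/
lemma program_length_le {k l n : ℕ} (hk : 2 ≤ k) (hl : 2 ^ l ≤ 8 * k ^ 2) :
    (((2 * l + 3) * 2 ^ n : ℕ) : ℝ) ≤ 13 / Real.log 2 * 2 ^ n * Real.log k := by
  have h2 : 0 < Real.log 2 := Real.log_pos one_lt_two
  have hk2 : (2 : ℝ) ≤ k := by exact_mod_cast hk
  have hlk : Real.log 2 ≤ Real.log k := Real.log_le_log two_pos hk2
  have h3 : l * Real.log 2 ≤ 3 * Real.log 2 + 2 * Real.log k := by
    have h4 : ((2 : ℝ) ^ l) ≤ 2 ^ 3 * k ^ 2 := by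
      have : ((2 ^ l : ℕ) : ℝ) ≤ ((8 * k ^ 2 : ℕ) : ℝ) := by exact_mod_cast hl
      push_cast at this
      linarith
    have := Real.log_le_log (by positivity) h4
    rw [Real.log_pow, Real.log_mul (by positivity) (by positivity), Real.log_pow,
      Real.log_pow] at this
    exact_mod_cast this
  have h5 : (2 * l + 3 : ℝ) ≤ 13 / Real.log 2 * Real.log k := by
    rw [div_mul_eq_mul_div, le_div_iff₀ h2]
    linarith
  push_cast
  calc ((2 * l + 3) * 2 ^ n : ℝ) ≤ (13 / Real.log 2 * Real.log k) * 2 ^ n :=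
        mul_le_mul_of_nonneg_right h5 (by positivity)
    _ = _ := by ring

end Assembly

end FastJL

theorem theorem1 :
    ∃ c₃ c₄ C : ℝ, 0 < c₃ ∧ 0 < c₄ ∧ 0 < C ∧
      -- the tail bound, for every 4-wise independent matrix
      (∀ (k n : ℕ) (B : Matrix (Fin k) (Fin (2 ^ n)) ℝ), FastJL.IsFourWiseIndependent B →
        ∀ (Ω : Type*) [MeasurableSpace Ω] (P : Measure Ω) [IsProbabilityMeasure P]
          (ξ ξ' : Fin (2 ^ n) → Ω → ℝ),
          FastJL.IsRademacher P ξ → FastJL.IsRademacher P ξ' →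
          IndepFun (fun ω j => ξ j ω) (fun ω j => ξ' j ω) P →
          ∀ x : EuclideanSpace ℝ (Fin (2 ^ n)), ‖x‖ = 1 → ∀ t : ℝ, 0 < t →
            P.real {ω | |‖WithLp.toLp 2 ((FastJL.jlMatrix B (fun j => ξ j ω)
                (fun j => ξ' j ω)).mulVec x.ofLp)‖ - 1| > t}
              ≤ c₃ * Real.exp (-c₄ * (k : ℝ) ^ (2 / 3 : ℝ) * t ^ (4 / 3 : ℝ))) ∧
      -- the running time, for a suitable 4-wise independent code matrix, which exists as soon
      -- as `4 * k ^ 2 ≤ d`, and whenever there is any 4-wise independent code matrix at all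
      (∀ k n : ℕ, 2 ≤ k →
        (4 * k ^ 2 ≤ 2 ^ n ∨ ∃ B₀ : Matrix (Fin k) (Fin (2 ^ n)) ℝ,
          FastJL.IsFourWiseIndependent B₀ ∧ FastJL.IsCodeMatrix B₀) →
        ∃ B : Matrix (Fin k) (Fin (2 ^ n)) ℝ,
          FastJL.IsFourWiseIndependent B ∧ FastJL.IsCodeMatrix B ∧
          ∀ s s' : Fin (2 ^ n) → ℝ,
            (∀ j, s j = 1 ∨ s j = -1) → (∀ j, s' j = 1 ∨ s' j = -1) →
            FastJL.ComputableInTime (fun x => (FastJL.jlMatrix B s s').mulVec x)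
              (C * 2 ^ n * Real.log k)) := by
  refine ⟨3, FastJL.tailConst, 13 / Real.log 2, by norm_num, FastJL.tailConst_pos,
    div_pos (by norm_num) (Real.log_pos one_lt_two), ?_, ?_⟩
  · intro k n B hB Ω _ P _ ξ ξ' hξ hξ' hind x hx t ht
    have hx2 : ∑ a, x.ofLp a ^ 2 = 1 := by
      have := EuclideanSpace.real_norm_sq_eq x
      rw [hx, one_pow] at this
      exact this.symm
    exact (FastJL.measureReal_le_expect hξ hξ' hind fun s s' =>
      |‖WithLp.toLp 2 ((FastJL.jlMatrix B s s').mulVec x.ofLp)‖ - 1| > t).trans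
        (hB.expect_tail_le hx2 ht)
  · intro k n hk h
    obtain ⟨l, m, rfl, hl, B, hB, hC, ρ, c, hρ⟩ := FastJL.exists_code_matrix hk h
    exact ⟨B, hB, hC, fun s s' _ _ =>
      (FastJL.hasProgram_jlMatrix hρ s s').computableInTime (FastJL.program_length_le hk hl)⟩
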